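/- Let $k\ge 1$ be an integer and $a,b\ge 0$. The symmetric stochastic block model $\mathrm{SBM}(n,k,a,b)$ is the law of a pair $(\sigma,G)$, where $\sigma\in[k]^n$ has independent labels uniform on $[k]$ and, given $\sigma$, $G$ is a random graph on $[n]$ in which every pair of distinct vertices $u,v$ is joined independently with probability $a/n$ if $\sigma_u=\sigma_v$ and $b/n$ if $\sigma_u\neq\sigma_v$ (for the finitely many $n$ for which such a value exceeds $1$, it is replaced by $1$). Write $\Omega_i=\{v:\sigma_v=i\}$ and, when $a+(k-1)b>0$, $$\mathrm{SNR}(k,a,b)=\frac{(a-b)^2}{k\,(a+(k-1)b)};$$ the Kesten-Stigum threshold is $\mathrm{SNR}=1$. Detection is (information-theoretically) solvable in $\mathrm{SBM}(n,k,a,b)$ if there are a map $A$, with no restriction on its complexity, that sends every graph $G$ on $[n]$ to a subset $S=A(G)$ of $[n]$, and an $\varepsilon>0$, such that with probability $1-o(1)$ as $n\to\infty$ there exist $i,j\in[k]$ with $$\frac{|\Omega_i\cap S|}{|\Omega_i|}-\frac{|\Omega_j\cap S|}{|\Omega_j|}>\varepsilon .$$ Max-detection is solvable in $\mathrm{SBM}(n,k,a,b)$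 if there are a map $\hat\sigma$ from graphs on $[n]$ to $[k]^n$ and an $\varepsilon>0$ such that with probability $1-o(1)$ $$\max_{\pi\in S_k}\frac1n\,\bigl|\{v:\sigma_v=\pi(\hat\sigma(G)_v)\}\bigr|\ \ge\ \frac1k+\varepsilon .$$ **Corollary.** For every integer $k\ge 4$ there are $a,b\ge 0$ with $a+(k-1)b>0$ and $\mathrm{SNR}(k,a,b)<1$, i.e. strictly below the Kesten-Stigum threshold, such that both detection and max-detection are information-theoretically solvable in $\mathrm{SBM}(n,k,a,b)$. For $k=4$ this happens already with $a=0$: there is $b>0$ with $\mathrm{SNR}(4,0,b)<1$ such that both detection and max-detection are information-theoretically solvable in $\mathrm{SBM}(n,4,0,b)$. -/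

import Mathlib

namespace BlockModel

/-- An assignment of `n` vertices to `k` communities. -/
abbrev Labels (n k : ℕ) : Type := Fin n → Fin k

/-- The unordered pairs of distinct vertices, each listed once as `(u, v)` with `u < v`. -/
def vertexPairs (n : ℕ) : Finset (Fin n × Fin n) :=
  Finset.univ.filter fun e => e.1 < e.2

/-- The probability of an edge between a vertex of community `i` and a vertex of community `j`
in the graph on `n` vertices: `Q i j / n`, cut off at `1` for the finitely many `n` below `Q i j`. -/
noncomputable def edgeProb {k : ℕ} (n : ℕ) (Q : Matrix (Fin k) (Fin k) ℝ) (i j : Fin k) : ℝ :=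
  min (Q i j / n) 1

open Classical in
/-- The conditional probability of the graph `G` given the community assignment `σ`: the edges
are independent. -/
noncomputable def graphWeight {n k : ℕ} (Q : Matrix (Fin k) (Fin k) ℝ) (σ : Labels n k)
    (G : SimpleGraph (Fin n)) : ℝ :=
  ∏ e ∈ vertexPairs n,
    if G.Adj e.1 e.2 then edgeProb n Q (σ e.1) (σ e.2) else 1 - edgeProb n Q (σ e.1) (σ e.2)

/-- The probability of the pair `(σ, G)` under `SBM(n, p, Q/n)`: the labels of the vertices are
independent with distribution `p`, and, given the labels, the edges are independent. -/
noncomputable def sbmWeight {n k : ℕ} (p : Fin k → ℝ) (Q : Matrix (Fin k) (Fin k) ℝ)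
    (σ : Labels n k) (G : SimpleGraph (Fin n)) : ℝ :=
  (∏ v, p (σ v)) * graphWeight Q σ G

open Classical in
/-- The probability of the event `E` when `(σ, G)` is drawn from `SBM(n, p, Q/n)`. -/
noncomputable def sbmProb {k : ℕ} (n : ℕ) (p : Fin k → ℝ) (Q : Matrix (Fin k) (Fin k) ℝ)
    (E : Labels n k → SimpleGraph (Fin n) → Prop) : ℝ :=
  ∑ σ : Labels n k, ∑ G : SimpleGraph (Fin n), if E σ G then sbmWeight p Q σ G else 0

/-- The community `Ω i` of all vertices labelled `i`. -/
def community {n k : ℕ} (σ : Labels n k) (i : Fin k) : Finset (Fin n) :=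
  Finset.univ.filter fun v => σ v = i

/-- The fraction `|Ω i ∩ S| / |Ω i|` of community `i` that lies in `S`. -/
noncomputable def fracIn {n k : ℕ} (σ : Labels n k) (S : Finset (Fin n)) (i : Fin k) : ℝ :=
  ((community σ i ∩ S).card : ℝ) / ((community σ i).card : ℝ)

/-- The algorithm `A`, which divides the vertices of a graph `G` into `A n G` and its complement,
solves detection in `SBM(n, p, Q/n)`: for some `ε > 0`, with probability `1 - o(1)` there are two
communities whose fractions lying in `A n G` differ by more than `ε`. -/
def SolvesDetection {k : ℕ} (p : Fin k → ℝ) (Q : Matrix (Fin k) (Fin k) ℝ)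
    (A : (n : ℕ) → SimpleGraph (Fin n) → Finset (Fin n)) : Prop :=
  ∃ ε : ℝ, 0 < ε ∧
    Filter.Tendsto
      (fun n : ℕ => sbmProb n p Q fun σ G =>
        ∃ i j : Fin k, ε < fracIn σ (A n G) i - fracIn σ (A n G) j)
      Filter.atTop (nhds 1)

/-- The agreement between two labellings: the largest fraction of vertices on which they agree
after a permutation of the labels of the second one. -/
noncomputable def agreement {n k : ℕ} (x y : Labels n k) : ℝ :=
  ⨆ π : Equiv.Perm (Fin k),
    ((Finset.univ.filter fun v => x v = π (y v)).card : ℝ) / (n : ℝ)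

/-- The algorithm `A`, which labels the vertices of a graph, solves max-detection in
`SBM(n, p, Q/n)`: for some `ε > 0`, with probability `1 - o(1)` its output has agreement at least
`max p i + ε` with the true labelling. -/
def SolvesMaxDetection {k : ℕ} (p : Fin k → ℝ) (Q : Matrix (Fin k) (Fin k) ℝ)
    (A : (n : ℕ) → SimpleGraph (Fin n) → Labels n k) : Prop :=
  ∃ ε : ℝ, 0 < ε ∧
    Filter.Tendsto
      (fun n : ℕ => sbmProb n p Q fun σ G => (⨆ i, p i) + ε ≤ agreement σ (A n G))
      Filter.atTop (nhds 1)

/-- The uniform distribution on the `k` communities. -/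
noncomputable def uniformDist (k : ℕ) : Fin k → ℝ := fun _ => 1 / (k : ℝ)

/-- The matrix with `a` on the diagonal and `b` off the diagonal. -/
def symmMatrix (k : ℕ) (a b : ℝ) : Matrix (Fin k) (Fin k) ℝ :=
  Matrix.of fun i j => if i = j then a else b

/-- Detection is solvable information-theoretically (by some algorithm, with no bound on its
complexity) in the symmetric model `SBM(n, k, a, b)`. -/
def DetectionSolvable (k : ℕ) (a b : ℝ) : Prop :=
  ∃ A : (n : ℕ) → SimpleGraph (Fin n) → Finset (Fin n),
    SolvesDetection (uniformDist k) (symmMatrix k a b) A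

/-- Max-detection is solvable information-theoretically in the symmetric model
`SBM(n, k, a, b)`. -/
def MaxDetectionSolvable (k : ℕ) (a b : ℝ) : Prop :=
  ∃ A : (n : ℕ) → SimpleGraph (Fin n) → Labels n k,
    SolvesMaxDetection (uniformDist k) (symmMatrix k a b) A

/-- The signal-to-noise ratio of `SBM(n, k, a, b)`; the Kesten-Stigum threshold is `snr = 1`. -/
noncomputable def snr (k : ℕ) (a b : ℝ) : ℝ :=
  (a - b) ^ 2 / ((k : ℝ) * (a + ((k : ℝ) - 1) * b))

end BlockModel

open Finset Filter Topology
open scoped Classical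

namespace BlockModel

/-! ### Finite expectations -/

/-! Take `a = 0`, so that the hidden labelling σ is a proper k-colouring of G, and b = k(k-1)(1-t),
which makes the signal-to-noise ratio 1-t. Fix a set C of two colours. Every proper colouring τ of G
proposes the set of vertices that it colours from C; call the proposal flat if it meets all
communities in nearly equal proportions. Suppose that with high probability G has at least exp(s'n)
candidate colourings, while the expected number of flat ones is at most poly(n)·exp(sn) with s < s'.
Then a uniformly random candidate is flat with exponentially small probability. To obtain a map from
graphs to sets, choose A(G) to minimise the posterior probability of being flat; it does at least as
well as the random candidate (`exists_selection`, `exists_set_sbmProb_le`,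
`detectionSolvable_of_exponent_lt`).

The expected number of flat colourings is computed by grouping τ according to its overlap ν with σ.
The number of τ with a given overlap is handled by the method of types
(`sum_exp_neg_condEntropy_le`), the probability that τ is proper by a Chernoff bound
(`graphExp_proper_le`). The expectation is taken only over graphs with at least the typical number
of edges; otherwise atypically sparse graphs inflate it too much. The tilt k/(k-1) is the inverse of
the chance that two independent uniform colours differ: at the uniform overlap the energy then
vanishes, and the exponent at t = 0 is log k - ((k-1)²/2) log(k/(k-1)). The exponent is jointly
continuous in t and ν and the overlaps form a compact set, so a strict bound at t = 0 persists for
small t > 0 (`eventually_exponent_lt`). This is how an estimate at the threshold yields detection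
strictly below it.

For k ≥ 5 the exponent over flat overlaps is negative (`exponent_zero_lt_of_five_le`), and σ alone
supplies enough candidates. For k = 4 its maximum is 2 log 2 - (9/2) log(4/3) ≈ 0.0917
(`exponent_zero_four_le`), so exponentially many candidates are needed. They come from σ by
recolouring single vertices that have no neighbour of the new colour. Compatible families of such
moves are the independent sets of a conflict graph, and correlation of decreasing events bounds
their number below by 2^|U| (3/4)^|P| (`card_independent_ge`, `card_proper_ge`). The resulting rate
3e⁻³ log 2 - 12e⁻⁶ log(4/3) exceeds 0.094.

Max-detection follows from detection by giving the detected set and its complement two different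
labels (`MaxDetectionSolvable.of_detectionSolvable`). -/

/-- The probability that a sum of random variables on a finite probability space deviates from its
mean is bounded by Chebyshev's inequality. -/
lemma chebyshev_sum {Ω ι : Type*} [Fintype Ω] (w : Ω → ℝ) (hw : ∀ x, 0 ≤ w x)
    (h1 : ∑ x, w x = 1) (I : Finset ι) (Y : ι → Ω → ℝ) {V a : ℝ} (ha : 0 < a)
    (hV : ∑ i ∈ I, ∑ j ∈ I, (∑ x, w x * (Y i x * Y j x)
      - (∑ x, w x * Y i x) * (∑ x, w x * Y j x)) ≤ V) :
    ∑ x, w x * (if a ≤ |∑ i ∈ I, Y i x - ∑ i ∈ I, ∑ x, w x * Y i x| then 1 else 0) ≤ V / a ^ 2 := by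
  set m := ∑ i ∈ I, ∑ x, w x * Y i x with hm
  have hmean : ∑ x, w x * ∑ i ∈ I, Y i x = m := by
    simp_rw [hm, mul_sum]; rw [sum_comm]
  have hsq : ∑ x, w x * (∑ i ∈ I, Y i x - m) ^ 2 ≤ V := by
    have : ∑ x, w x * (∑ i ∈ I, Y i x - m) ^ 2
        = ∑ x, w x * (∑ i ∈ I, Y i x) ^ 2 - m ^ 2 := by
      have : ∀ x, w x * (∑ i ∈ I, Y i x - m) ^ 2 = w x * (∑ i ∈ I, Y i x) ^ 2
          - 2 * m * (w x * ∑ i ∈ I, Y i x) + m ^ 2 * w x := fun x => by ring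
      simp_rw [this, sum_add_distrib, sum_sub_distrib, ← mul_sum, hmean, h1]
      ring
    rw [this]
    refine le_trans (le_of_eq ?_) hV
    simp_rw [sum_sub_distrib]
    congr 1
    · simp_rw [sq, sum_mul_sum, mul_sum]
      rw [sum_comm]
      refine sum_congr rfl fun i _ => ?_
      rw [sum_comm]
    · rw [sq, hm, sum_mul_sum]
  rw [le_div_iff₀ (by positivity), sum_mul]
  refine le_trans (sum_le_sum fun x _ => ?_) hsq
  rw [mul_assoc]
  refine mul_le_mul_of_nonneg_left ?_ (hw x)
  split_ifs with h
  · rw [one_mul, ← sq_abs (∑ i ∈ I, Y i x - m)]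
    exact pow_le_pow_left₀ ha.le h 2
  · simp only [zero_mul]; positivity

/-! ### Expectations over the graph -/

lemma mem_vertexPairs {n : ℕ} {e : Fin n × Fin n} : e ∈ vertexPairs n ↔ e.1 < e.2 := by
  simp [vertexPairs]

/-- A product over the pairs of functions of the single edges, summed over all graphs. -/
lemma sum_graph_prod {n : ℕ} (g : Fin n × Fin n → Prop → ℝ) :
    ∑ G : SimpleGraph (Fin n), ∏ e ∈ vertexPairs n, g e (G.Adj e.1 e.2)
      = ∏ e ∈ vertexPairs n, (g e True + g e False) := by
  rw [prod_add]
  refine sum_bij' (fun G _ => (vertexPairs n).filter fun e => G.Adj e.1 e.2)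
    (fun t _ => SimpleGraph.fromRel fun u v => u < v ∧ (u, v) ∈ t) ?_ ?_ ?_ ?_ ?_
  · intro G _
    simp
  · intro t _
    simp
  · intro G _
    ext u v
    simp only [SimpleGraph.fromRel_adj, mem_filter, mem_vertexPairs]
    constructor
    · rintro ⟨_, h | h⟩
      · exact h.2.2
      · exact h.2.2.symm
    · intro h
      refine ⟨h.ne, ?_⟩
      rcases lt_or_gt_of_ne h.ne with h' | h'
      · exact Or.inl ⟨h', h', h⟩
      · exact Or.inr ⟨h', h', h.symm⟩
  · intro t ht
    ext ⟨u, v⟩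
    have ht' := mem_powerset.1 ht
    simp only [SimpleGraph.fromRel_adj, mem_filter, mem_vertexPairs]
    constructor
    · rintro ⟨h, _, h' | h'⟩
      · exact h'.2
      · exact absurd h'.1 (not_lt.2 h.le)
    · intro h
      have := mem_vertexPairs.1 (ht' h)
      exact ⟨this, this.ne, Or.inl ⟨this, h⟩⟩
  · intro G _
    rw [← prod_filter_mul_prod_filter_not (vertexPairs n) (fun e => G.Adj e.1 e.2)]
    congr 1
    · refine prod_congr rfl fun e he => ?_
      rw [eq_true (mem_filter.1 he).2]
    · rw [filter_not]
      refine prod_congr rfl fun e he => ?_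
      have : ¬ G.Adj e.1 e.2 := by
        intro h
        rw [Finset.mem_sdiff, mem_filter] at he
        exact he.2 ⟨he.1, h⟩
      rw [eq_false this]

/-- The conditional expectation of `f G` given the labels `σ`. -/
noncomputable def graphExp {n k : ℕ} (Q : Matrix (Fin k) (Fin k) ℝ) (σ : Labels n k)
    (f : SimpleGraph (Fin n) → ℝ) : ℝ :=
  ∑ G, graphWeight Q σ G * f G

/-- The probability that the pair `e` is an edge given the labels `σ`. -/
noncomputable def pairProb {n k : ℕ} (Q : Matrix (Fin k) (Fin k) ℝ) (σ : Labels n k)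
    (e : Fin n × Fin n) : ℝ :=
  edgeProb n Q (σ e.1) (σ e.2)

variable {n k : ℕ} {Q : Matrix (Fin k) (Fin k) ℝ}

lemma pairProb_nonneg (hQ : ∀ i j, 0 ≤ Q i j) (σ : Labels n k) (e) : 0 ≤ pairProb Q σ e :=
  le_min (div_nonneg (hQ _ _) n.cast_nonneg) zero_le_one

lemma pairProb_le_one (σ : Labels n k) (e) : pairProb Q σ e ≤ 1 := min_le_right _ _

lemma graphWeight_nonneg (hQ : ∀ i j, 0 ≤ Q i j) (σ : Labels n k) (G) :
    0 ≤ graphWeight Q σ G := by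
  refine prod_nonneg fun e _ => ?_
  have h0 := pairProb_nonneg hQ σ e
  have h1 := pairProb_le_one (Q := Q) σ e
  unfold pairProb at h0 h1
  split_ifs
  · exact h0
  · linarith

lemma graphExp_prod (σ : Labels n k) (g : Fin n × Fin n → Prop → ℝ) :
    graphExp Q σ (fun G => ∏ e ∈ vertexPairs n, g e (G.Adj e.1 e.2))
      = ∏ e ∈ vertexPairs n,
        (pairProb Q σ e * g e True + (1 - pairProb Q σ e) * g e False) := by
  have := sum_graph_prod (n := n)
    (fun e q => (if q then pairProb Q σ e else 1 - pairProb Q σ e) * g e q)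
  simp only [if_true, if_false] at this
  rw [← this]
  unfold graphExp graphWeight
  refine sum_congr rfl fun G _ => ?_
  rw [← prod_mul_distrib]
  rfl

lemma sum_graphWeight (σ : Labels n k) : ∑ G, graphWeight Q σ G = 1 := by
  have := graphExp_prod (Q := Q) σ (fun _ _ => 1)
  simpa [graphExp] using this

lemma graphExp_mono (hQ : ∀ i j, 0 ≤ Q i j) (σ : Labels n k) {f g : SimpleGraph (Fin n) → ℝ}
    (h : ∀ G, f G ≤ g G) : graphExp Q σ f ≤ graphExp Q σ g :=
  sum_le_sum fun G _ => mul_le_mul_of_nonneg_left (h G) (graphWeight_nonneg hQ σ G)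

lemma graphExp_nonneg (hQ : ∀ i j, 0 ≤ Q i j) (σ : Labels n k) {f : SimpleGraph (Fin n) → ℝ}
    (h : ∀ G, 0 ≤ f G) : 0 ≤ graphExp Q σ f :=
  sum_nonneg fun G _ => mul_nonneg (graphWeight_nonneg hQ σ G) (h G)

lemma graphExp_add (σ : Labels n k) (f g : SimpleGraph (Fin n) → ℝ) :
    graphExp Q σ (fun G => f G + g G) = graphExp Q σ f + graphExp Q σ g := by
  simp only [graphExp, mul_add, sum_add_distrib]

lemma graphExp_const_mul (σ : Labels n k) (c : ℝ) (f : SimpleGraph (Fin n) → ℝ) :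
    graphExp Q σ (fun G => c * f G) = c * graphExp Q σ f := by
  simp only [graphExp, mul_sum, mul_left_comm]

/-- The indicator of the event that all pairs in `H` are edges and no pair in `K` is. -/
noncomputable def cylinder (H K : Finset (Fin n × Fin n)) (G : SimpleGraph (Fin n)) : ℝ :=
  if (∀ e ∈ H, G.Adj e.1 e.2) ∧ ∀ e ∈ K, ¬ G.Adj e.1 e.2 then 1 else 0

lemma cylinder_nonneg (H K : Finset (Fin n × Fin n)) (G : SimpleGraph (Fin n)) :
    0 ≤ cylinder H K G := by
  unfold cylinder; split_ifs <;> norm_num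

lemma cylinder_mul (H K H' K' : Finset (Fin n × Fin n)) (G : SimpleGraph (Fin n)) :
    cylinder H K G * cylinder H' K' G = cylinder (H ∪ H') (K ∪ K') G := by
  unfold cylinder
  simp only [mem_union, or_imp, forall_and]
  split_ifs <;> first | tauto | simp

lemma cylinder_anti {H K H' K' : Finset (Fin n × Fin n)} (hH : H ⊆ H') (hK : K ⊆ K')
    (G : SimpleGraph (Fin n)) : cylinder H' K' G ≤ cylinder H K G := by
  unfold cylinder
  split_ifs with h h'
  · exact le_rfl
  · exact absurd ⟨fun e he => h.1 e (hH he), fun e he => h.2 e (hK he)⟩ h'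
  · exact zero_le_one
  · exact le_rfl

lemma graphExp_cylinder (σ : Labels n k) {H K : Finset (Fin n × Fin n)}
    (hH : H ⊆ vertexPairs n) (hK : K ⊆ vertexPairs n) (hd : Disjoint H K) :
    graphExp Q σ (cylinder H K)
      = (∏ e ∈ H, pairProb Q σ e) * ∏ e ∈ K, (1 - pairProb Q σ e) := by
  have h : cylinder H K = fun G : SimpleGraph (Fin n) => ∏ e ∈ vertexPairs n,
      (fun (e : Fin n × Fin n) (q : Prop) =>
        (if (e ∈ H → q) ∧ (e ∈ K → ¬ q) then (1 : ℝ) else 0)) e (G.Adj e.1 e.2) := by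
    funext G
    unfold cylinder
    rw [prod_ite_zero]
    simp only [prod_const_one]
    refine if_congr ?_ rfl rfl
    constructor
    · rintro ⟨h1, h2⟩ e _
      exact ⟨h1 e, h2 e⟩
    · intro h
      exact ⟨fun e he => (h e (hH he)).1 he, fun e he => (h e (hK he)).2 he⟩
  rw [h]
  refine (graphExp_prod σ (fun e q =>
    if (e ∈ H → q) ∧ (e ∈ K → ¬ q) then (1 : ℝ) else 0)).trans ?_
  have eH : ∏ e ∈ H, pairProb Q σ e = ∏ e ∈ vertexPairs n, if e ∈ H then pairProb Q σ e else 1 := by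
    rw [← prod_subset hH (fun e _ he => if_neg he)]
    exact prod_congr rfl fun e he => (if_pos he).symm
  have eK : ∏ e ∈ K, (1 - pairProb Q σ e)
      = ∏ e ∈ vertexPairs n, if e ∈ K then 1 - pairProb Q σ e else 1 := by
    rw [← prod_subset hK (fun e _ he => if_neg he)]
    exact prod_congr rfl fun e he => (if_pos he).symm
  rw [eH, eK, ← prod_mul_distrib]
  refine prod_congr rfl fun e _ => ?_
  by_cases h1 : e ∈ H
  · have h2 : e ∉ K := disjoint_left.1 hd h1
    simp [h1, h2]
  · by_cases h2 : e ∈ K <;> simp [h1, h2]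

/-- Events that depend on disjoint sets of pairs are independent given the labels; this removes
nearly all covariances in the Chebyshev bounds below. -/
lemma graphExp_cylinder_mul (σ : Labels n k) {H K H' K' : Finset (Fin n × Fin n)}
    (hH : H ⊆ vertexPairs n) (hK : K ⊆ vertexPairs n) (hd : Disjoint H K)
    (hH' : H' ⊆ vertexPairs n) (hK' : K' ⊆ vertexPairs n) (hd' : Disjoint H' K')
    (hdd : Disjoint (H ∪ K) (H' ∪ K')) :
    graphExp Q σ (fun G => cylinder H K G * cylinder H' K' G)
      = graphExp Q σ (cylinder H K) * graphExp Q σ (cylinder H' K') := by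
  simp only [disjoint_union_left, disjoint_union_right] at hdd
  obtain ⟨⟨h1, h2⟩, h3, h4⟩ := hdd
  simp_rw [cylinder_mul]
  rw [graphExp_cylinder σ hH hK hd, graphExp_cylinder σ hH' hK' hd',
    graphExp_cylinder σ (union_subset hH hH') (union_subset hK hK'), prod_union h1,
    prod_union h4]
  · ring
  · simp only [disjoint_union_left, disjoint_union_right]
    exact ⟨⟨hd, h2.symm⟩, h3, hd'⟩

/-- Chebyshev's inequality for the conditional law of the graph. -/
lemma graphExp_chebyshev {ι : Type*} (hQ : ∀ i j, 0 ≤ Q i j) (σ : Labels n k) (I : Finset ι)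
    (Y : ι → SimpleGraph (Fin n) → ℝ) {V a : ℝ} (ha : 0 < a)
    (hV : ∑ i ∈ I, ∑ j ∈ I, (graphExp Q σ (fun G => Y i G * Y j G)
      - graphExp Q σ (Y i) * graphExp Q σ (Y j)) ≤ V) :
    graphExp Q σ (fun G => if a ≤ |∑ i ∈ I, Y i G - ∑ i ∈ I, graphExp Q σ (Y i)|
      then 1 else 0) ≤ V / a ^ 2 :=
  chebyshev_sum (graphWeight Q σ) (graphWeight_nonneg hQ σ) (sum_graphWeight σ) I Y ha hV

/-! ### Probabilities in the block model and negligible events -/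

section SbmProb

variable {k : ℕ} {p : Fin k → ℝ} {Q : Matrix (Fin k) (Fin k) ℝ}

lemma sbmProb_eq (n : ℕ) (p : Fin k → ℝ) (Q : Matrix (Fin k) (Fin k) ℝ)
    (E : Labels n k → SimpleGraph (Fin n) → Prop) :
    sbmProb n p Q E = ∑ σ : Labels n k, (∏ v, p (σ v)) *
      graphExp Q σ (fun G => if E σ G then 1 else 0) := by
  unfold sbmProb graphExp sbmWeight
  refine sum_congr rfl fun σ _ => ?_
  rw [mul_sum]
  refine sum_congr rfl fun G _ => ?_
  by_cases h : E σ G <;> simp [h]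

lemma sum_labels_prod {n k : ℕ} (g : Fin n → Fin k → ℝ) :
    ∑ σ : Labels n k, ∏ v, g v (σ v) = ∏ v, ∑ i, g v i := by
  rw [prod_univ_sum, Fintype.piFinset_univ]

lemma sum_labels_weight (n : ℕ) (hp1 : ∑ i, p i = 1) :
    ∑ σ : Labels n k, ∏ v, p (σ v) = 1 := by
  rw [sum_labels_prod (fun _ => p)]
  simp [hp1]

lemma sbmWeight_nonneg {n : ℕ} (hp : ∀ i, 0 ≤ p i) (hQ : ∀ i j, 0 ≤ Q i j) (σ : Labels n k) (G) :
    0 ≤ sbmWeight p Q σ G :=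
  mul_nonneg (prod_nonneg fun _ _ => hp _) (graphWeight_nonneg hQ σ G)

lemma sbmProb_nonneg {n : ℕ} (hp : ∀ i, 0 ≤ p i) (hQ : ∀ i j, 0 ≤ Q i j)
    (E : Labels n k → SimpleGraph (Fin n) → Prop) : 0 ≤ sbmProb n p Q E :=
  sum_nonneg fun σ _ => sum_nonneg fun G _ => by
    split_ifs
    · exact sbmWeight_nonneg hp hQ σ G
    · exact le_rfl

lemma sbmProb_mono {n : ℕ} (hp : ∀ i, 0 ≤ p i) (hQ : ∀ i j, 0 ≤ Q i j)
    {E F : Labels n k → SimpleGraph (Fin n) → Prop} (h : ∀ σ G, E σ G → F σ G) :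
    sbmProb n p Q E ≤ sbmProb n p Q F :=
  sum_le_sum fun σ _ => sum_le_sum fun G _ => by
    have := sbmWeight_nonneg hp hQ σ G
    split_ifs with h1 h2 h2
    · exact le_rfl
    · exact absurd (h _ _ h1) h2
    · exact this
    · exact le_rfl

lemma sbmProb_or_le {n : ℕ} (hp : ∀ i, 0 ≤ p i) (hQ : ∀ i j, 0 ≤ Q i j)
    (E F : Labels n k → SimpleGraph (Fin n) → Prop) :
    sbmProb n p Q (fun σ G => E σ G ∨ F σ G) ≤ sbmProb n p Q E + sbmProb n p Q F := by
  unfold sbmProb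
  simp_rw [← sum_add_distrib]
  refine sum_le_sum fun σ _ => sum_le_sum fun G _ => ?_
  have := sbmWeight_nonneg hp hQ σ G
  split_ifs <;> first | tauto | linarith

lemma sbmProb_compl (n : ℕ) (hp1 : ∑ i, p i = 1) (E : Labels n k → SimpleGraph (Fin n) → Prop) :
    sbmProb n p Q E = 1 - sbmProb n p Q (fun σ G => ¬ E σ G) := by
  rw [eq_sub_iff_add_eq, sbmProb_eq, sbmProb_eq, ← sum_add_distrib]
  refine Eq.trans ?_ (sum_labels_weight (p := p) n hp1)
  refine sum_congr rfl fun σ _ => ?_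
  rw [← mul_add, ← graphExp_add]
  refine (congrArg _ (?_ : graphExp Q σ _ = 1)).trans (mul_one _)
  rw [← sum_graphWeight (Q := Q) σ]
  refine sum_congr rfl fun G _ => ?_
  by_cases h : E σ G <;> simp [h, sum_graphWeight]

/-- If the event `E` has conditional probability at most `c` given every labelling in `B`, then
`B` and `E` occur together with probability at most `c`. -/
lemma sbmProb_and_le {n : ℕ} (hp : ∀ i, 0 ≤ p i) (hp1 : ∑ i, p i = 1)
    {B : Labels n k → Prop} {E : Labels n k → SimpleGraph (Fin n) → Prop} {c : ℝ} (hc : 0 ≤ c)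
    (h : ∀ σ, B σ → graphExp Q σ (fun G => if E σ G then 1 else 0) ≤ c) :
    sbmProb n p Q (fun σ G => B σ ∧ E σ G) ≤ c := by
  rw [sbmProb_eq]
  calc _ ≤ ∑ σ : Labels n k, (∏ v, p (σ v)) * c := by
        refine sum_le_sum fun σ _ => mul_le_mul_of_nonneg_left ?_ (prod_nonneg fun _ _ => hp _)
        by_cases hB : B σ
        · simpa [hB] using h σ hB
        · simpa [hB, graphExp] using hc
    _ = c := by rw [← sum_mul, sum_labels_weight n hp1, one_mul]

/-- An event whose complement is negligible has probability tending to `1`. -/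
lemma tendsto_sbmProb_one (hp1 : ∑ i, p i = 1)
    {E : (n : ℕ) → Labels n k → SimpleGraph (Fin n) → Prop}
    (h : Tendsto (fun n => sbmProb n p Q (fun σ G => ¬ E n σ G)) atTop (𝓝 0)) :
    Tendsto (fun n => sbmProb n p Q (E n)) atTop (𝓝 1) := by
  have := h.const_sub 1
  rw [sub_zero] at this
  exact this.congr fun n => (sbmProb_compl n hp1 (E n)).symm

lemma tendsto_sbmProb_not (hp1 : ∑ i, p i = 1)
    {E : (n : ℕ) → Labels n k → SimpleGraph (Fin n) → Prop}
    (h : Tendsto (fun n => sbmProb n p Q (E n)) atTop (𝓝 1)) :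
    Tendsto (fun n => sbmProb n p Q (fun σ G => ¬ E n σ G)) atTop (𝓝 0) := by
  have := h.const_sub 1
  rw [sub_self] at this
  refine this.congr fun n => ?_
  rw [sbmProb_compl n hp1 (E n)]
  ring

/-- Negligible events are closed under taking unions and passing to smaller events. -/
lemma tendsto_sbmProb_zero_of_imp_or (hp : ∀ i, 0 ≤ p i) (hQ : ∀ i j, 0 ≤ Q i j)
    {E F G : (n : ℕ) → Labels n k → SimpleGraph (Fin n) → Prop}
    (hE : Tendsto (fun n => sbmProb n p Q (E n)) atTop (𝓝 0))
    (hF : Tendsto (fun n => sbmProb n p Q (F n)) atTop (𝓝 0))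
    (h : ∀ᶠ n in atTop, ∀ σ g, G n σ g → E n σ g ∨ F n σ g) :
    Tendsto (fun n => sbmProb n p Q (G n)) atTop (𝓝 0) := by
  have h0 := hE.add hF
  rw [add_zero] at h0
  refine tendsto_of_tendsto_of_tendsto_of_le_of_le' tendsto_const_nhds h0
    (Eventually.of_forall fun n => sbmProb_nonneg hp hQ _) ?_
  filter_upwards [h] with n hn
  exact (sbmProb_mono hp hQ hn).trans (sbmProb_or_le hp hQ _ _)

lemma tendsto_sbmProb_exists {ι : Type*} [Fintype ι] (hp : ∀ i, 0 ≤ p i) (hQ : ∀ i j, 0 ≤ Q i j)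
    {E : ι → (n : ℕ) → Labels n k → SimpleGraph (Fin n) → Prop}
    (h : ∀ i, Tendsto (fun n => sbmProb n p Q (E i n)) atTop (𝓝 0)) :
    Tendsto (fun n => sbmProb n p Q (fun σ G => ∃ i, E i n σ G)) atTop (𝓝 0) := by
  suffices H : ∀ s : Finset ι,
      Tendsto (fun n => sbmProb n p Q (fun σ G => ∃ i ∈ s, E i n σ G)) atTop (𝓝 0) by
    simpa using H univ
  intro s
  induction s using Finset.induction_on with
  | empty => simp [sbmProb]
  | insert a s _ ih =>
    refine tendsto_sbmProb_zero_of_imp_or hp hQ (h a) ih (Eventually.of_forall fun n σ g => ?_)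
    rintro ⟨i, hi, hE⟩
    rcases mem_insert.1 hi with rfl | hi
    · exact Or.inl hE
    · exact Or.inr ⟨i, hi, hE⟩

end SbmProb

/-! ### Community sizes -/

/-- All communities have size within `t * n` of `n / k`. -/
def Balanced {n k : ℕ} (t : ℝ) (σ : Labels n k) : Prop :=
  ∀ i, |((community σ i).card : ℝ) / n - 1 / k| ≤ t

lemma uniformDist_nonneg (k : ℕ) (i : Fin k) : 0 ≤ uniformDist k i := by
  unfold uniformDist; positivity

lemma sum_uniformDist {k : ℕ} (hk : k ≠ 0) : ∑ i, uniformDist k i = 1 := by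
  simp [uniformDist, hk]

/-- The indicators of `σ v = i` are uncorrelated for distinct vertices and have variance at most 1,
so the community size has variance at most n and Chebyshev applies. -/
lemma sum_labels_deviation_le {n k : ℕ} (hk : k ≠ 0) (hn : 0 < n) {t : ℝ} (ht : 0 < t)
    (i : Fin k) :
    ∑ σ : Labels n k, (∏ v, uniformDist k (σ v)) *
      (if t < |((community σ i).card : ℝ) / n - 1 / k| then 1 else 0) ≤ 1 / t ^ 2 / n := by
  have hn' : (0 : ℝ) < n := by exact_mod_cast hn
  have hk' : (k : ℝ) ≠ 0 := by exact_mod_cast hk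
  set w : Labels n k → ℝ := fun σ => ∏ v, uniformDist k (σ v) with hw
  have hw0 : ∀ σ, 0 ≤ w σ := fun σ => prod_nonneg fun _ _ => uniformDist_nonneg _ _
  have hw1 : ∑ σ, w σ = 1 := sum_labels_weight n (sum_uniformDist hk)
  set Y : Fin n → Labels n k → ℝ := fun v σ => if σ v = i then 1 else 0 with hY
  have hEY : ∀ v, ∑ σ, w σ * Y v σ = 1 / k := by
    intro v
    have := sum_labels_prod (n := n) (k := k)
      (fun u j => uniformDist k j * if u = v then (if j = i then 1 else 0) else 1)
    simp only [prod_mul_distrib, prod_ite_eq', mem_univ, if_true] at this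
    rw [this, prod_eq_single v]
    · simp [uniformDist]
    · intro u _ hu
      simp [hu, sum_uniformDist hk]
    · simp
  have hcov : ∀ u v, u ≠ v → ∑ σ, w σ * (Y u σ * Y v σ) = 1 / k * (1 / k) := by
    intro u v huv
    have := sum_labels_prod (n := n) (k := k)
      (fun x j => uniformDist k j * ((if x = u then (if j = i then 1 else 0) else 1) *
        (if x = v then (if j = i then 1 else 0) else 1)))
    simp only [prod_mul_distrib, prod_ite_eq', mem_univ, if_true] at this
    rw [this, ← mul_prod_erase univ _ (mem_univ u),
      ← mul_prod_erase (univ.erase u) _ (mem_erase.2 ⟨huv.symm, mem_univ v⟩), prod_eq_one]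
    · simp [uniformDist, huv, huv.symm]
    · intro x hx
      simp only [mem_erase] at hx
      simp [hx.1, hx.2.1, sum_uniformDist hk]
  have hV : ∑ u ∈ (univ : Finset (Fin n)), ∑ v ∈ (univ : Finset (Fin n)),
      (∑ σ, w σ * (Y u σ * Y v σ) - (∑ σ, w σ * Y u σ) * (∑ σ, w σ * Y v σ)) ≤ (n : ℝ) := by
    calc _ ≤ ∑ u : Fin n, ∑ v : Fin n, (if u = v then (1 : ℝ) else 0) := by
          refine sum_le_sum fun u _ => sum_le_sum fun v _ => ?_
          split_ifs with h
          · subst h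
            have h1 : ∑ σ, w σ * (Y u σ * Y u σ) ≤ ∑ σ, w σ := by
              refine sum_le_sum fun σ _ => mul_le_of_le_one_right (hw0 σ) ?_
              simp only [hY]; split_ifs <;> norm_num
            rw [hEY]
            have : (0 : ℝ) ≤ 1 / k * (1 / k) := by positivity
            linarith
          · rw [hcov u v h, hEY, hEY, sub_self]
      _ = n := by simp
  have := chebyshev_sum w hw0 hw1 univ Y (a := t * n) (by positivity) hV
  refine le_trans (sum_le_sum fun σ _ => mul_le_mul_of_nonneg_left ?_ (hw0 σ)) (this.trans ?_)
  · have hc : ((community σ i).card : ℝ) = ∑ v, Y v σ := by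
      simp [hY, community]
    have hm : ∑ v : Fin n, ∑ σ, w σ * Y v σ = n / k := by
      simp only [hEY, sum_const, card_univ, Fintype.card_fin, nsmul_eq_mul]
      ring
    rw [hm, ← hc]
    have : |((community σ i).card : ℝ) / n - 1 / k| * n = |((community σ i).card : ℝ) - n / k| := by
      rw [← abs_of_pos hn', ← abs_mul, abs_of_pos hn']
      congr 1
      field_simp
    by_cases h : t < |((community σ i).card : ℝ) / n - 1 / k|
    · rw [if_pos h, if_pos]
      rw [← this]
      exact mul_le_mul_of_nonneg_right h.le hn'.le
    · rw [if_neg h]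
      split_ifs <;> norm_num
  · apply le_of_eq
    field_simp

lemma tendsto_sbmProb_not_balanced {k : ℕ} (hk : k ≠ 0) {Q : Matrix (Fin k) (Fin k) ℝ}
    (hQ : ∀ i j, 0 ≤ Q i j) {t : ℝ} (ht : 0 < t) :
    Tendsto (fun n => sbmProb n (uniformDist k) Q (fun σ _ => ¬ Balanced t σ)) atTop (𝓝 0) := by
  simp only [Balanced, not_forall, not_le]
  refine tendsto_sbmProb_exists (E := fun i n σ _ => t < |((community σ i).card : ℝ) / n - 1 / k|)
    (uniformDist_nonneg k) hQ fun i => ?_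
  refine tendsto_of_tendsto_of_tendsto_of_le_of_le' tendsto_const_nhds
    (tendsto_const_div_atTop_nhds_zero_nat (1 / t ^ 2))
    (Eventually.of_forall fun n => sbmProb_nonneg (uniformDist_nonneg k) hQ _) ?_
  filter_upwards [eventually_gt_atTop 0] with n hn
  rw [sbmProb_eq]
  refine le_trans (le_of_eq ?_) (sum_labels_deviation_le hk hn ht i)
  refine sum_congr rfl fun σ _ => ?_
  rw [graphExp, ← sum_mul, sum_graphWeight, one_mul]

/-! ### Max-detection from detection -/

lemma exists_perm_apply_eq {k : ℕ} {x y i j : Fin k} (hxy : x ≠ y) (hij : i ≠ j) :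
    ∃ π : Equiv.Perm (Fin k), π x = i ∧ π y = j := by
  have hw : Equiv.swap x i y ≠ i := by
    intro h
    have : Equiv.swap x i y = Equiv.swap x i x := by rw [h, Equiv.swap_apply_left]
    exact hxy ((Equiv.injective _ this).symm)
  refine ⟨Equiv.swap (Equiv.swap x i y) j * Equiv.swap x i, ?_, ?_⟩
  · rw [Equiv.Perm.mul_apply, Equiv.swap_apply_left, Equiv.swap_apply_of_ne_of_ne hw.symm hij]
  · rw [Equiv.Perm.mul_apply, Equiv.swap_apply_left]

lemma fracIn_mem_Icc {n k : ℕ} (σ : Labels n k) (S : Finset (Fin n)) (i : Fin k) :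
    0 ≤ fracIn σ S i ∧ fracIn σ S i ≤ 1 := by
  unfold fracIn
  refine ⟨by positivity, div_le_one_of_le₀ ?_ (by positivity)⟩
  exact_mod_cast card_le_card inter_subset_left

lemma card_mul_fracIn {n k : ℕ} (σ : Labels n k) (S : Finset (Fin n)) (i : Fin k) :
    ((community σ i).card : ℝ) * fracIn σ S i = ((community σ i ∩ S).card : ℝ) := by
  unfold fracIn
  rcases eq_or_ne ((community σ i).card) 0 with h | h
  · have : (community σ i ∩ S).card = 0 :=
      Nat.le_zero.1 (h ▸ card_le_card inter_subset_left)
    simp [h, this]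
  · field_simp

/-- Labelling a set that splits the communities unevenly and its complement by two different labels
agrees with the truth better than a constant labelling. -/
lemma le_agreement_of_fracIn {n k : ℕ} (hn : 0 < n) (σ : Labels n k) (S : Finset (Fin n)) {x y : Fin k}
    (hxy : x ≠ y) {ε t : ℝ} (hσ : Balanced t σ) (hε : 0 < ε)
    (h : ∃ i j, ε < fracIn σ S i - fracIn σ S j) :
    1 / k + (ε / k - 3 * t) ≤ agreement σ (fun v => if v ∈ S then x else y) := by
  obtain ⟨i, j, hij⟩ := h
  have hn' : (0 : ℝ) < n := by exact_mod_cast hn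
  have hne : i ≠ j := by
    rintro rfl
    rw [sub_self] at hij
    exact absurd hij (not_lt.2 hε.le)
  obtain ⟨π, hπi, hπj⟩ := exists_perm_apply_eq hxy hne
  have key : ((univ.filter fun v => σ v = π (if v ∈ S then x else y)).card : ℝ) / n
      ≤ agreement σ (fun v => if v ∈ S then x else y) :=
    le_ciSup (f := fun π : Equiv.Perm (Fin k) =>
      ((univ.filter fun v => σ v = π (if v ∈ S then x else y)).card : ℝ) / n)
      (Set.finite_range _).bddAbove π
  refine le_trans ?_ key
  have hcard : ((community σ i ∩ S).card : ℝ) + ((community σ j).card - (community σ j ∩ S).card)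
      ≤ ((univ.filter fun v => σ v = π (if v ∈ S then x else y)).card : ℝ) := by
    have h1 : ((community σ j).card : ℝ) - (community σ j ∩ S).card = (community σ j \ S).card := by
      rw [sub_eq_iff_eq_add, add_comm]
      exact_mod_cast (card_inter_add_card_sdiff (community σ j) S).symm
    rw [h1]
    have hd : Disjoint (community σ i ∩ S) (community σ j \ S) := by
      rw [disjoint_left]
      intro v hv hv'
      exact (Finset.mem_sdiff.1 hv').2 (mem_inter.1 hv).2
    have hc := card_union_of_disjoint hd
    have : (community σ i ∩ S) ∪ (community σ j \ S)
        ⊆ univ.filter fun v => σ v = π (if v ∈ S then x else y) := by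
      intro v hv
      simp only [community, mem_union, mem_inter, mem_filter, mem_univ, true_and,
        Finset.mem_sdiff] at hv ⊢
      rcases hv with ⟨h, h'⟩ | ⟨h, h'⟩
      · rw [if_pos h', h, hπi]
      · rw [if_neg h', h, hπj]
    have := card_le_card this
    rw [hc] at this
    exact_mod_cast this
  rw [← card_mul_fracIn, ← card_mul_fracIn] at hcard
  refine le_trans ?_ (div_le_div_of_nonneg_right hcard hn'.le)
  have hi := abs_le.1 (hσ i)
  have hj := abs_le.1 (hσ j)
  set a := ((community σ i).card : ℝ) / n with ha
  set b := ((community σ j).card : ℝ) / n with hb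
  have e : (((community σ i).card : ℝ) * fracIn σ S i + ((community σ j).card
      - (community σ j).card * fracIn σ S j)) / n
      = a * fracIn σ S i + b * (1 - fracIn σ S j) := by
    rw [ha, hb]; field_simp
  rw [e]
  obtain ⟨p0, p1⟩ := fracIn_mem_Icc σ S i
  obtain ⟨q0, q1⟩ := fracIn_mem_Icc σ S j
  have t0 : 0 ≤ t := by linarith
  have e1 : (1 / k - t) * fracIn σ S i ≤ a * fracIn σ S i :=
    mul_le_mul_of_nonneg_right (by linarith) p0
  have e2 : (1 / k - t) * (1 - fracIn σ S j) ≤ b * (1 - fracIn σ S j) :=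
    mul_le_mul_of_nonneg_right (by linarith) (by linarith)
  have e3 : ε / k ≤ 1 / k * (fracIn σ S i - fracIn σ S j) := by
    rw [div_eq_mul_one_div, mul_comm]
    exact mul_le_mul_of_nonneg_left hij.le (by positivity)
  nlinarith

lemma iSup_uniformDist {k : ℕ} (hk : k ≠ 0) : ⨆ i, uniformDist k i = 1 / k := by
  have : Nonempty (Fin k) := ⟨⟨0, Nat.pos_of_ne_zero hk⟩⟩
  simp [uniformDist]

/-- In the model with uniform labels, max-detection is solvable if detection is. -/
theorem MaxDetectionSolvable.of_detectionSolvable {k : ℕ} (hk : 2 ≤ k) {a b : ℝ} (ha : 0 ≤ a)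
    (hb : 0 ≤ b) (h : DetectionSolvable k a b) : MaxDetectionSolvable k a b := by
  obtain ⟨A, ε, hε, hA⟩ := h
  have hk0 : k ≠ 0 := by omega
  have hk' : (0 : ℝ) < k := by positivity
  have hQ : ∀ i j, 0 ≤ symmMatrix k a b i j := by
    intro i j
    simp only [symmMatrix, Matrix.of_apply]
    split_ifs <;> assumption
  set x : Fin k := ⟨0, by omega⟩
  set y : Fin k := ⟨1, by omega⟩
  have hxy : x ≠ y := by simp [x, y]
  -- The margin ε/(2k) is what is left of ε/k - 3t for the balance tolerance t = ε/(6k).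
  refine ⟨fun n G v => if v ∈ A n G then x else y, ε / (2 * k), by positivity, ?_⟩
  refine tendsto_sbmProb_one (sum_uniformDist hk0) ?_
  refine tendsto_sbmProb_zero_of_imp_or (uniformDist_nonneg k) hQ
    (tendsto_sbmProb_not (sum_uniformDist hk0) hA)
    (tendsto_sbmProb_not_balanced hk0 hQ (t := ε / (6 * k)) (by positivity)) ?_
  filter_upwards [eventually_gt_atTop 0] with n hn σ G hG
  by_contra! hcon
  refine hG (le_trans (le_of_eq ?_) (le_agreement_of_fracIn hn σ (A n G) hxy hcon.2 hε hcon.1))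
  rw [iSup_uniformDist hk0]
  field_simp
  ring

/-! ### Choosing the best set for the posterior -/

/-- The set minimizing the posterior probability of being bad is bad at most as often as the set
read off from a uniformly random member of `T G`. -/
lemma exists_selection {n k : ℕ} {p : Fin k → ℝ} {Q : Matrix (Fin k) (Fin k) ℝ}
    (hp : ∀ i, 0 ≤ p i) (hQ : ∀ i j, 0 ≤ Q i j) (T : SimpleGraph (Fin n) → Finset (Labels n k))
    (S : Labels n k → Finset (Fin n)) (bad : Labels n k → Finset (Fin n) → Prop)
    (Ev : Labels n k → SimpleGraph (Fin n) → Prop) {L : ℝ}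
    (hT : ∀ σ G, Ev σ G → L ≤ (T G).card) :
    ∃ A : SimpleGraph (Fin n) → Finset (Fin n),
      L * sbmProb n p Q (fun σ G => Ev σ G ∧ bad σ (A G)) ≤
        ∑ σ : Labels n k, ∑ G : SimpleGraph (Fin n), ∑ τ ∈ T G,
          if Ev σ G ∧ bad σ (S τ) then sbmWeight p Q σ G else 0 := by
  -- Up to normalisation, the posterior probability given G that the event holds and U is bad; A(G)
  -- minimises it over all U.
  set f : SimpleGraph (Fin n) → Finset (Fin n) → ℝ := fun G U =>
    ∑ σ : Labels n k, if Ev σ G ∧ bad σ U then sbmWeight p Q σ G else 0 with hf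
  have hf0 : ∀ G U, 0 ≤ f G U := fun G U => sum_nonneg fun σ _ => by
    split_ifs
    · exact sbmWeight_nonneg hp hQ σ G
    · exact le_rfl
  choose A hA using fun G => Finite.exists_min (f G)
  refine ⟨A, ?_⟩
  have e1 : sbmProb n p Q (fun σ G => Ev σ G ∧ bad σ (A G)) = ∑ G, f G (A G) := by
    unfold sbmProb
    rw [sum_comm]
    refine sum_congr rfl fun G _ => sum_congr rfl fun σ _ => ?_
    by_cases h : Ev σ G ∧ bad σ (A G)
    · rw [if_pos h]
      exact (if_pos h).symm
    · rw [if_neg h]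
      exact (if_neg h).symm
  have e2 : (∑ σ : Labels n k, ∑ G : SimpleGraph (Fin n), ∑ τ ∈ T G,
      if Ev σ G ∧ bad σ (S τ) then sbmWeight p Q σ G else 0) = ∑ G, ∑ τ ∈ T G, f G (S τ) := by
    rw [sum_comm]
    refine sum_congr rfl fun G _ => ?_
    rw [sum_comm]
  rw [e1, e2, mul_sum]
  refine sum_le_sum fun G _ => ?_
  -- A minimum is at most each of the values at the members of `T G`, of which there are at least L.
  -- If no labelling is compatible with the event, the left side vanishes and no bound on `T G` is
  -- needed.
  by_cases h : ∃ σ, Ev σ G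
  · obtain ⟨σ, hσ⟩ := h
    calc L * f G (A G) ≤ (T G).card * f G (A G) :=
          mul_le_mul_of_nonneg_right (hT σ G hσ) (hf0 _ _)
      _ = ∑ τ ∈ T G, f G (A G) := by rw [sum_const, nsmul_eq_mul]
      _ ≤ ∑ τ ∈ T G, f G (S τ) := sum_le_sum fun τ _ => hA G (S τ)
  · have : f G (A G) = 0 := sum_eq_zero fun σ _ => if_neg fun h' => h ⟨σ, h'.1⟩
    rw [this, mul_zero]
    exact sum_nonneg fun τ _ => hf0 _ _

/-! ### The expected number of colourings -/

/-- The labelling `τ` is a proper colouring of `G`. -/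
def Proper {n k : ℕ} (G : SimpleGraph (Fin n)) (τ : Labels n k) : Prop :=
  ∀ u v, G.Adj u v → τ u ≠ τ v

/-- The number of edges of `G`. -/
noncomputable def edgeCount {n : ℕ} (G : SimpleGraph (Fin n)) : ℝ :=
  ∑ e ∈ vertexPairs n, if G.Adj e.1 e.2 then 1 else 0

lemma symmMatrix_zero_nonneg {k : ℕ} {b : ℝ} (hb : 0 ≤ b) (i j : Fin k) :
    0 ≤ symmMatrix k 0 b i j := by
  simp only [symmMatrix, Matrix.of_apply]
  split_ifs
  · exact le_rfl
  · exact hb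

lemma pairProb_symmMatrix {n k : ℕ} {b : ℝ} (hn : b ≤ n) (hn0 : 0 < n) (σ : Labels n k)
    (e : Fin n × Fin n) :
    pairProb (symmMatrix k 0 b) σ e = if σ e.1 = σ e.2 then 0 else b / n := by
  have hn' : (0 : ℝ) < n := by exact_mod_cast hn0
  simp only [pairProb, edgeProb, symmMatrix, Matrix.of_apply]
  split_ifs
  · simp
  · exact min_eq_left ((div_le_one hn').2 hn)

/-- The exponential moment bound for the probability that `τ` is a proper colouring and the graph
has at least `M` edges. -/
lemma graphExp_proper_le {n k : ℕ} {b l M : ℝ} (hb : 0 ≤ b) (hn : b ≤ n) (hn0 : 0 < n)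
    (hl : 0 ≤ l) (σ τ : Labels n k) :
    graphExp (symmMatrix k 0 b) σ (fun G => if Proper G τ ∧ M ≤ edgeCount G then 1 else 0) ≤
      Real.exp (-(l * M) + b / n * ∑ e ∈ vertexPairs n, if σ e.1 = σ e.2 then 0 else
        (if τ e.1 = τ e.2 then 0 else Real.exp l) - 1) := by
  have hn' : (0 : ℝ) < n := by exact_mod_cast hn0
  -- An edge costs a factor 0 if τ makes it monochromatic and earns exp l otherwise. The product is
  -- exp(l · number of edges) on proper colourings, which dominates exp(l M) there.
  set g : Fin n × Fin n → Prop → ℝ := fun e q =>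
    if q then (if τ e.1 = τ e.2 then 0 else Real.exp l) else 1 with hg
  have hg0 : ∀ e q, 0 ≤ g e q := by
    intro e q
    simp only [hg]
    split_ifs <;> positivity
  have hG : ∀ G : SimpleGraph (Fin n), (if Proper G τ ∧ M ≤ edgeCount G then (1 : ℝ) else 0) ≤
      Real.exp (-(l * M)) * ∏ e ∈ vertexPairs n, g e (G.Adj e.1 e.2) := by
    intro G
    split_ifs with h
    · have : ∏ e ∈ vertexPairs n, g e (G.Adj e.1 e.2) = Real.exp (l * edgeCount G) := by
        rw [edgeCount, mul_sum, Real.exp_sum]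
        refine prod_congr rfl fun e _ => ?_
        by_cases he : G.Adj e.1 e.2
        · simp [hg, he, h.1 _ _ he]
        · simp [hg, he]
      rw [this, ← Real.exp_add, ← Real.exp_zero]
      refine Real.exp_le_exp.2 ?_
      have := mul_le_mul_of_nonneg_left h.2 hl
      linarith
    · exact mul_nonneg (Real.exp_pos _).le (prod_nonneg fun e _ => hg0 _ _)
  refine (graphExp_mono (symmMatrix_zero_nonneg hb) σ hG).trans ?_
  rw [graphExp_const_mul, graphExp_prod, Real.exp_add]
  refine mul_le_mul_of_nonneg_left ?_ (Real.exp_pos _).le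
  rw [mul_sum, Real.exp_sum]
  refine prod_le_prod (fun e _ => ?_) fun e _ => ?_
  · have h0 := pairProb_nonneg (symmMatrix_zero_nonneg hb) σ e
    have h1 := pairProb_le_one (Q := symmMatrix k 0 b) σ e
    have := hg0 e True
    have := hg0 e False
    have : 0 ≤ 1 - pairProb (symmMatrix k 0 b) σ e := by linarith
    positivity
  · rw [pairProb_symmMatrix hn hn0]
    by_cases hσ : σ e.1 = σ e.2
    · simp [hσ, hg]
    · simp only [hσ, hg, if_true, if_false]
      -- Here 1 + x ≤ exp x with x the edge probability times the factor minus 1.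
      refine le_trans (le_of_eq ?_) (Real.add_one_le_exp _)
      ring

/-- The fraction of vertices labelled `i` by `σ` and `c` by `τ`. -/
noncomputable def overlap {n k : ℕ} (σ τ : Labels n k) (i c : Fin k) : ℝ :=
  ((univ.filter fun v => σ v = i ∧ τ v = c).card : ℝ) / n

/-- The quadratic part of the exponent of the expected number of colourings. -/
noncomputable def energy {k : ℕ} (θ : ℝ) (ν : Fin k → Fin k → ℝ) : ℝ :=
  (θ - 1) * (1 - ∑ i, (∑ c, ν i c) ^ 2) - θ * ∑ c, (∑ i, ν i c) ^ 2 + θ * ∑ i, ∑ c, ν i c ^ 2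

/-- The conditional entropy of the column given the row under the weights `ν`. -/
noncomputable def condEntropy {k : ℕ} (ν : Fin k → Fin k → ℝ) : ℝ :=
  ∑ i, ∑ c, Real.negMulLog (ν i c) - ∑ i, Real.negMulLog (∑ c, ν i c)

lemma sum_vertexPairs {n : ℕ} (f : Fin n × Fin n → ℝ) (hs : ∀ u v, f (u, v) = f (v, u))
    (hd : ∀ u, f (u, u) = 0) :
    ∑ e ∈ vertexPairs n, f e = 1 / 2 * ∑ u, ∑ v, f (u, v) := by
  have h1 : ∑ u, ∑ v, f (u, v) = ∑ e : Fin n × Fin n, f e := (Fintype.sum_prod_type f).symm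
  have h2 : ∑ e ∈ univ.filter (fun e : Fin n × Fin n => e.2 < e.1), f e
      = ∑ e ∈ vertexPairs n, f e := by
    refine sum_bij' (fun e _ => e.swap) (fun e _ => e.swap) ?_ ?_ ?_ ?_ ?_
    all_goals simp [mem_vertexPairs]
    intro a b _
    exact hs a b
  have h3 : ∑ e : Fin n × Fin n, f e = ∑ e ∈ vertexPairs n, f e
      + ∑ e ∈ univ.filter (fun e : Fin n × Fin n => e.2 < e.1), f e := by
    rw [← sum_filter_add_sum_filter_not univ (fun e : Fin n × Fin n => e.1 < e.2)]
    congr 1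
    symm
    refine sum_subset (fun e he => ?_) fun e he he' => ?_
    · simp only [mem_filter, mem_univ, true_and, not_lt] at he ⊢
      exact he.le
    · simp only [mem_filter, mem_univ, true_and, not_lt] at he he'
      obtain ⟨u, v⟩ := e
      obtain rfl : u = v := le_antisymm he' he
      exact hd u
  rw [h1, h3, h2]
  ring

lemma sum_sum_ite_eq_eq {n : ℕ} {κ : Type*} [Fintype κ] [DecidableEq κ] (f : Fin n → κ) :
    ∑ u, ∑ v, (if f u = f v then (1 : ℝ) else 0)
      = ∑ i, ((univ.filter fun v => f v = i).card : ℝ) ^ 2 := by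
  have : ∀ u v, (if f u = f v then (1 : ℝ) else 0)
      = ∑ i, (if f u = i then 1 else 0) * (if f v = i then 1 else 0) := by
    intro u v
    simp [eq_comm]
  simp_rw [this]
  rw [sum_congr rfl fun u _ => sum_comm, sum_comm]
  refine sum_congr rfl fun i _ => ?_
  rw [← sum_mul_sum]
  simp [sq]

lemma sum_overlap_right {n k : ℕ} (σ τ : Labels n k) (i : Fin k) :
    ∑ c, overlap σ τ i c = ((univ.filter fun v => σ v = i).card : ℝ) / n := by
  unfold overlap
  rw [← sum_div]
  congr 1
  rw [card_eq_sum_card_fiberwise (f := τ) (t := univ) (fun _ _ => by simp)]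
  push_cast
  refine sum_congr rfl fun c _ => ?_
  rw [filter_filter]

lemma sum_overlap_left {n k : ℕ} (σ τ : Labels n k) (c : Fin k) :
    ∑ i, overlap σ τ i c = ((univ.filter fun v => τ v = c).card : ℝ) / n := by
  rw [← sum_overlap_right τ σ c]
  refine sum_congr rfl fun i _ => ?_
  unfold overlap
  simp only [and_comm]

/-- The identity is exact because the summand vanishes when both vertices coincide. Counting pairs
with equal σ-labels, equal τ-labels, or both, gives the squares of the row sums, the column sums and
the entries of the overlap. -/
lemma exponent_eq {n k : ℕ} (hn : 0 < n) (σ τ : Labels n k) (b θ : ℝ) :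
    b / n * ∑ e ∈ vertexPairs n, (if σ e.1 = σ e.2 then 0 else
        (if τ e.1 = τ e.2 then 0 else θ) - 1) = n * (b / 2 * energy θ (overlap σ τ)) := by
  have hn' : (n : ℝ) ≠ 0 := by exact_mod_cast hn.ne'
  rw [sum_vertexPairs (fun e => if σ e.1 = σ e.2 then 0 else
        (if τ e.1 = τ e.2 then 0 else θ) - 1)]
  rotate_left
  · intro u v
    simp only [eq_comm]
  · simp
  have h : ∀ u v, (if σ u = σ v then 0 else (if τ u = τ v then 0 else θ) - 1)
      = (θ - 1) * (1 - if σ u = σ v then (1 : ℝ) else 0) - θ * (if τ u = τ v then (1 : ℝ) else 0)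
        + θ * (if (σ u, τ u) = (σ v, τ v) then (1 : ℝ) else 0) := by
    intro u v
    simp only [Prod.mk.injEq]
    by_cases h1 : σ u = σ v <;> by_cases h2 : τ u = τ v <;> simp [h1, h2]
  simp_rw [h, sum_add_distrib, sum_sub_distrib, ← mul_sum, sum_sub_distrib]
  rw [sum_sum_ite_eq_eq, sum_sum_ite_eq_eq, sum_sum_ite_eq_eq (fun v => (σ v, τ v)),
    Fintype.sum_prod_type]
  unfold energy
  simp_rw [sum_overlap_right, sum_overlap_left, overlap, div_pow, ← sum_div, Prod.mk.injEq]
  simp only [sum_const, card_univ, Fintype.card_fin, nsmul_eq_mul]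
  field_simp

/-! ### Counting colourings by type -/

lemma prod_pow_card_fiber {n : ℕ} {κ : Type*} [Fintype κ] [DecidableEq κ] (f : Fin n → κ) (q : κ → ℝ) :
    ∏ v, q (f v) = ∏ x, q x ^ (univ.filter fun v => f v = x).card := by
  rw [← prod_fiberwise_of_maps_to (s := univ) (t := univ) (g := f) (fun _ _ => mem_univ _)]
  refine prod_congr rfl fun x _ => ?_
  rw [← prod_const]
  refine prod_congr rfl fun v hv => ?_
  rw [(mem_filter.1 hv).2]

lemma pow_eq_exp_mul_log {N : ℕ} {x : ℝ} (hx : 0 ≤ x) (h : x = 0 → N = 0) :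
    x ^ N = Real.exp (N * Real.log x) := by
  rcases hx.eq_or_lt with h0 | h0
  · simp [h h0.symm]
  · rw [mul_comm, Real.exp_mul, Real.exp_log h0, Real.rpow_natCast]

/-- One row of the log-likelihood of τ under its own empirical conditional distribution given σ.
Zero counts cause no trouble since their terms vanish on both sides. -/
lemma sum_mul_log_div_eq {k : ℕ} {n : ℝ} (hn : 0 < n) (N : Fin k → ℕ) :
    ∑ c, (N c : ℝ) * Real.log (N c / ∑ c, (N c : ℝ))
      = -(n * (∑ c, Real.negMulLog (N c / n) - Real.negMulLog ((∑ c, (N c : ℝ)) / n))) := by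
  set m := ∑ c, (N c : ℝ) with hm
  have e1 : ∀ c, (N c : ℝ) * Real.log (N c / m)
      = -(n * Real.negMulLog (N c / n)) - N c * Real.log (m / n) := by
    intro c
    rcases Nat.eq_zero_or_pos (N c) with h | h
    · simp [h]
    · have hc : (0 : ℝ) < N c := by exact_mod_cast h
      have hm0 : 0 < m := hc.trans_le
        (single_le_sum (f := fun c => (N c : ℝ)) (fun c _ => by positivity) (mem_univ c))
      have e2 : n * Real.negMulLog (N c / n) = -(N c * Real.log (N c / n)) := by
        rw [Real.negMulLog, ← mul_assoc, mul_neg, mul_div_cancel₀ _ hn.ne', neg_mul]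
      rw [e2, Real.log_div hc.ne' hm0.ne', Real.log_div hc.ne' hn.ne',
        Real.log_div hm0.ne' hn.ne']
      ring
  have e3 : n * Real.negMulLog (m / n) = -(m * Real.log (m / n)) := by
    rw [Real.negMulLog, ← mul_assoc, mul_neg, mul_div_cancel₀ _ hn.ne', neg_mul]
  rw [sum_congr rfl fun c _ => e1 c, sum_sub_distrib, sum_neg_distrib, ← mul_sum, ← sum_mul,
    ← hm, mul_sub, e3]
  ring

/-- The sum over all `τ` of the inverse of the entropy bound for the number of labellings with the
overlap of `τ` is polynomial in `n`. -/
lemma sum_exp_neg_condEntropy_le {n k : ℕ} (hn : 0 < n) (σ : Labels n k) :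
    ∑ τ : Labels n k, Real.exp (-(n * condEntropy (overlap σ τ))) ≤ (n + 1 : ℝ) ^ (k * k) := by
  have hn' : (0 : ℝ) < n := by exact_mod_cast hn
  set ty : Labels n k → (Fin k × Fin k → Fin (n + 1)) := fun τ x =>
    ⟨(univ.filter fun v => (σ v, τ v) = x).card,
      Nat.lt_succ_of_le (by simpa using card_le_univ (univ.filter fun v => (σ v, τ v) = x))⟩ with hty
  -- The conditional law of the τ-label given the σ-label that belongs to the count table N. Under
  -- the law read off from its own table, τ has probability exp(-n · conditional entropy). Summing
  -- over every table overcounts, but each table contributes total mass at most 1 and there are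
  -- (n+1)^(k²) tables.
  set q : (Fin k × Fin k → Fin (n + 1)) → Fin k × Fin k → ℝ := fun N x =>
    ((N x : ℕ) : ℝ) / ∑ c, ((N (x.1, c) : ℕ) : ℝ) with hq
  have hq0 : ∀ N x, 0 ≤ q N x := fun N x => by simp only [hq]; positivity
  have h1 : ∀ τ, Real.exp (-(n * condEntropy (overlap σ τ))) = ∏ v, q (ty τ) (σ v, τ v) := by
    intro τ
    rw [prod_pow_card_fiber (fun v => (σ v, τ v)) (q (ty τ))]
    set N : Fin k × Fin k → ℕ := fun x => (univ.filter fun v => (σ v, τ v) = x).card with hN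
    have hqN : ∀ x, q (ty τ) x = (N x : ℝ) / ∑ c, (N (x.1, c) : ℝ) := fun x => rfl
    have hz : ∀ x, q (ty τ) x = 0 → N x = 0 := by
      intro x hx
      rw [hqN, div_eq_zero_iff] at hx
      rcases hx with hx | hx
      · exact_mod_cast hx
      · have := (sum_eq_zero_iff_of_nonneg (fun c _ => by positivity)).1 hx x.2 (mem_univ _)
        exact_mod_cast this
    have hov : ∀ i c, overlap σ τ i c = (N (i, c) : ℝ) / n := by
      intro i c
      simp [overlap, hN]
    have hexp : ∀ x, q (ty τ) x ^ N x = Real.exp (N x * Real.log (q (ty τ) x)) :=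
      fun x => pow_eq_exp_mul_log (hq0 _ x) (hz x)
    rw [prod_congr rfl fun x _ => hexp x, ← Real.exp_sum, Fintype.sum_prod_type]
    congr 1
    unfold condEntropy
    rw [← sum_sub_distrib, mul_sum, ← sum_neg_distrib]
    refine sum_congr rfl fun i _ => ?_
    simp only [hqN, hov]
    rw [← sum_div]
    exact (sum_mul_log_div_eq hn' fun c => N (i, c)).symm
  calc ∑ τ : Labels n k, Real.exp (-(n * condEntropy (overlap σ τ)))
      ≤ ∑ τ : Labels n k, ∑ N : Fin k × Fin k → Fin (n + 1), ∏ v, q N (σ v, τ v) := by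
        refine sum_le_sum fun τ _ => ?_
        rw [h1]
        exact single_le_sum (f := fun N => ∏ v, q N (σ v, τ v))
          (fun N _ => prod_nonneg fun v _ => hq0 _ _) (mem_univ (ty τ))
    _ = ∑ N : Fin k × Fin k → Fin (n + 1), ∏ v, ∑ c, q N (σ v, c) := by
        rw [sum_comm]
        refine sum_congr rfl fun N _ => ?_
        rw [← sum_labels_prod (fun v c => q N (σ v, c))]
    _ ≤ ∑ N : Fin k × Fin k → Fin (n + 1), 1 := by
        refine sum_le_sum fun N _ => prod_le_one (fun v _ => sum_nonneg fun c _ => hq0 _ _)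
          fun v _ => ?_
        simp only [hq]
        rw [← sum_div]
        exact div_self_le_one _
    _ = (n + 1 : ℝ) ^ (k * k) := by
        simp

/-! ### The number of edges -/

lemma edgeCount_eq_sum_cylinder {n : ℕ} (G : SimpleGraph (Fin n)) :
    edgeCount G = ∑ e ∈ vertexPairs n, cylinder {e} ∅ G := by
  unfold edgeCount cylinder
  simp

/-- The expected number of edges divided by `n`, given the labels. -/
noncomputable def meanEdges {k : ℕ} (b : ℝ) (ν : Fin k → Fin k → ℝ) : ℝ :=
  b / 2 * (1 - ∑ i, (∑ c, ν i c) ^ 2)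

lemma sum_pairProb {n k : ℕ} {b : ℝ} (hn : b ≤ n) (hn0 : 0 < n) (σ τ : Labels n k) :
    ∑ e ∈ vertexPairs n, pairProb (symmMatrix k 0 b) σ e = n * meanEdges b (overlap σ τ) := by
  have hn' : (n : ℝ) ≠ 0 := by exact_mod_cast hn0.ne'
  rw [sum_congr rfl fun e _ => pairProb_symmMatrix hn hn0 σ e, sum_vertexPairs]
  · have h : ∀ u v, (if σ u = σ v then 0 else b / n)
        = b / n * (1 - if σ u = σ v then (1 : ℝ) else 0) := by
      intro u v
      split_ifs <;> simp
    simp_rw [h, ← mul_sum, sum_sub_distrib]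
    rw [sum_sum_ite_eq_eq, meanEdges]
    simp_rw [sum_overlap_right, div_pow, ← sum_div]
    simp only [sum_const, card_univ, Fintype.card_fin, nsmul_eq_mul]
    field_simp
  · intro u v
    simp only [eq_comm]
  · simp

/-- Distinct pairs are independent, each variance is at most b/n, and there are at most n² pairs, so
the variance is at most bn. Only the lower tail matters, since the tilt is used on graphs with many
edges. -/
lemma graphExp_edgeCount_lt_le {n k : ℕ} {b t : ℝ} (hb : 0 ≤ b) (hn : b ≤ n) (hn0 : 0 < n)
    (ht : 0 < t) (σ τ : Labels n k) :
    graphExp (symmMatrix k 0 b) σ (fun G =>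
      if edgeCount G < n * (meanEdges b (overlap σ τ) - t) then 1 else 0) ≤ b / t ^ 2 / n := by
  have hn' : (0 : ℝ) < n := by exact_mod_cast hn0
  have hQ := symmMatrix_zero_nonneg (k := k) hb
  have hE : ∀ e ∈ vertexPairs n, graphExp (symmMatrix k 0 b) σ (cylinder {e} ∅)
      = pairProb (symmMatrix k 0 b) σ e := by
    intro e he
    rw [graphExp_cylinder σ (singleton_subset_iff.2 he) (empty_subset _) (disjoint_empty_right _)]
    simp
  have hV : ∑ e ∈ vertexPairs n, ∑ e' ∈ vertexPairs n,
      (graphExp (symmMatrix k 0 b) σ (fun G => cylinder {e} ∅ G * cylinder {e'} ∅ G)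
      - graphExp (symmMatrix k 0 b) σ (cylinder {e} ∅) *
        graphExp (symmMatrix k 0 b) σ (cylinder {e'} ∅)) ≤ b * n := by
    calc _ ≤ ∑ e ∈ vertexPairs n, ∑ e' ∈ vertexPairs n, if e = e' then b / n else 0 := by
          refine sum_le_sum fun e he => sum_le_sum fun e' he' => ?_
          split_ifs with h
          · subst h
            simp_rw [cylinder_mul, union_self]
            rw [hE e he]
            have h0 := pairProb_nonneg hQ σ e
            have h1 : pairProb (symmMatrix k 0 b) σ e ≤ b / n := by
              rw [pairProb_symmMatrix hn hn0]
              split_ifs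
              · positivity
              · exact le_rfl
            have := mul_nonneg h0 h0
            linarith
          · rw [graphExp_cylinder_mul σ (singleton_subset_iff.2 he) (empty_subset _)
              (disjoint_empty_right _) (singleton_subset_iff.2 he') (empty_subset _)
              (disjoint_empty_right _) (by simpa using h), sub_self]
      _ ≤ ∑ e ∈ vertexPairs n, b / n := by
          refine sum_le_sum fun e he => ?_
          rw [sum_ite_eq, if_pos he]
      _ ≤ b * n := by
          rw [sum_const, nsmul_eq_mul]
          have h1 : ((vertexPairs n).card : ℝ) ≤ n * n := by
            have := card_le_univ (vertexPairs n)
            rw [Fintype.card_prod, Fintype.card_fin] at this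
            exact_mod_cast this
          calc ((vertexPairs n).card : ℝ) * (b / n) ≤ n * n * (b / n) :=
                mul_le_mul_of_nonneg_right h1 (by positivity)
            _ = b * n := by field_simp
  have := graphExp_chebyshev hQ σ (vertexPairs n) (fun e => cylinder {e} ∅) (a := t * n)
    (by positivity) hV
  rw [sum_congr rfl hE, sum_pairProb hn hn0 σ τ] at this
  refine le_trans (graphExp_mono hQ σ fun G => ?_) (this.trans (le_of_eq (by field_simp)))
  rw [← edgeCount_eq_sum_cylinder]
  by_cases h : edgeCount G < n * (meanEdges b (overlap σ τ) - t)
  · rw [if_pos h, if_pos]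
    rw [abs_sub_comm]
    refine le_trans ?_ (le_abs_self _)
    linarith
  · rw [if_neg h]
    split_ifs <;> norm_num

/-! ### The exponent and its continuity -/

/-- The parameter `b` of the model with `a = 0` and signal-to-noise ratio `1 - t`. -/
noncomputable def bParam (k : ℕ) (t : ℝ) : ℝ := k * (k - 1) * (1 - t)

/-- The tilting factor for the edges. -/
noncomputable def tilt (k : ℕ) : ℝ := k / (k - 1)

/-- The exponential growth rate of the expected number of colourings with overlap `ν` on the event
that the graph does not have too few edges. -/
noncomputable def exponent {k : ℕ} (t : ℝ) (ν : Fin k → Fin k → ℝ) : ℝ :=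
  condEntropy ν + bParam k t / 2 * energy (tilt k) ν
    - Real.log (tilt k) * (meanEdges (bParam k t) ν - t)

/-- Up to errors of size `t`, the rows of `ν` have equal sums and equal partial sums over `C`, and
the total weight of `C` is within `r` of `|C| / k`. -/
def FlatOverlap {k : ℕ} (C : Finset (Fin k)) (r t : ℝ) (ν : Fin k → Fin k → ℝ) : Prop :=
  (∀ i, |∑ c, ν i c - 1 / k| ≤ t) ∧
  (∀ i j, (∑ c ∈ C, ν i c) * (∑ c, ν j c) - (∑ c ∈ C, ν j c) * (∑ c, ν i c) ≤ t) ∧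
  |∑ i, ∑ c ∈ C, ν i c - C.card / k| ≤ r + k * t

lemma continuous_exponent {k : ℕ} :
    Continuous (fun z : ℝ × (Fin k → Fin k → ℝ) => exponent z.1 z.2) := by
  unfold exponent condEntropy energy meanEdges bParam
  have := Real.continuous_negMulLog
  fun_prop

lemma isClosed_flatOverlap {k : ℕ} (C : Finset (Fin k)) (r : ℝ) :
    IsClosed {z : ℝ × (Fin k → Fin k → ℝ) | FlatOverlap C r z.1 z.2} := by
  simp only [FlatOverlap, Set.ofPred_and, Set.ofPred_forall]
  refine IsClosed.inter (isClosed_iInter fun i => ?_) (IsClosed.inter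
    (isClosed_iInter fun i => isClosed_iInter fun j => ?_) ?_)
  all_goals exact isClosed_le (by fun_prop) (by fun_prop)

/-- Compactness turns a strict bound at the threshold into one for all nearby t. Near `(0, ν)`
either the exponent stays below s by continuity, or ν is not flat at t = 0 and remains so nearby
because flatness is a closed condition. -/
lemma eventually_exponent_lt {k : ℕ} {C : Finset (Fin k)} {r s : ℝ}
    (h : ∀ ν : Fin k → Fin k → ℝ, (∀ i c, 0 ≤ ν i c) → (∀ i, ∑ c, ν i c = 1 / k) →
      (∀ i j, ∑ c ∈ C, ν i c = ∑ c ∈ C, ν j c) →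
      |∑ i, ∑ c ∈ C, ν i c - C.card / k| ≤ r → exponent 0 ν < s) :
    ∀ᶠ t : ℝ in 𝓝 0, ∀ ν ∈ Set.Icc (0 : Fin k → Fin k → ℝ) 1, FlatOverlap C r t ν →
      exponent t ν < s := by
  refine IsCompact.eventually_forall_of_forall_eventually
    (P := fun t ν => FlatOverlap C r t ν → exponent t ν < s) isCompact_Icc fun ν hν => ?_
  by_cases hf : FlatOverlap C r 0 ν
  · have hlt : exponent 0 ν < s := by
      obtain ⟨h1, h2, h3⟩ := hf
      have h1' : ∀ i, ∑ c, ν i c = 1 / k := fun i =>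
        sub_eq_zero.1 (abs_nonpos_iff.1 (h1 i))
      refine h ν (fun i c => hν.1 i c) h1' (fun i j => ?_) (by simpa using h3)
      have hk : (0 : ℝ) < 1 / k := by
        have : 0 < k := i.pos
        positivity
      have a1 := h2 i j
      have a2 := h2 j i
      rw [h1', h1', ← sub_mul] at a1 a2
      have a3 := nonpos_of_mul_nonpos_left a1 hk
      have a4 := nonpos_of_mul_nonpos_left a2 hk
      linarith
    have := (continuous_exponent (k := k)).continuousAt (x := (0, ν)) |>.eventually_lt_const hlt
    filter_upwards [this] with z hz _
    exact hz
  · have : ∀ᶠ z : ℝ × (Fin k → Fin k → ℝ) in 𝓝 (0, ν), ¬ FlatOverlap C r z.1 z.2 :=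
      (isClosed_flatOverlap C r).isOpen_compl.eventually_mem hf
    filter_upwards [this] with z hz h'
    exact absurd h' hz

/-! ### Detection from a bound on the exponent -/

/-- The vertices with labels in `C`. -/
def colorSet {n k : ℕ} (C : Finset (Fin k)) (τ : Labels n k) : Finset (Fin n) :=
  univ.filter fun v => τ v ∈ C

/-- The proper colourings for which the fraction of vertices with colours in `C` is within `q` of
`|C| / k`. -/
noncomputable def colorings {n k : ℕ} (C : Finset (Fin k)) (q : ℝ) (G : SimpleGraph (Fin n)) :
    Finset (Labels n k) :=
  univ.filter fun τ => Proper G τ ∧ |((colorSet C τ).card : ℝ) / n - C.card / k| ≤ q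

lemma overlap_mem_Icc {n k : ℕ} (σ τ : Labels n k) :
    overlap σ τ ∈ Set.Icc (0 : Fin k → Fin k → ℝ) 1 := by
  constructor
  · intro i c
    simp only [overlap, Pi.zero_apply]
    positivity
  · intro i c
    simp only [overlap, Pi.one_apply]
    refine div_le_one_of_le₀ ?_ (by positivity)
    have := card_le_univ (univ.filter fun v => σ v = i ∧ τ v = c)
    rw [Fintype.card_fin] at this
    exact_mod_cast this

lemma sum_overlap_colorSet {n k : ℕ} (C : Finset (Fin k)) (σ τ : Labels n k) (i : Fin k) :
    ∑ c ∈ C, overlap σ τ i c = ((community σ i ∩ colorSet C τ).card : ℝ) / n := by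
  unfold overlap
  rw [← sum_div]
  congr 1
  rw [card_eq_sum_card_fiberwise (f := τ) (t := C) (fun v hv => by
    simp only [colorSet, coe_inter, coe_filter, mem_univ, true_and, Set.mem_inter_iff,
      Set.mem_ofPred_eq] at hv
    exact hv.2)]
  push_cast
  refine sum_congr rfl fun c hc => ?_
  congr 2
  ext v
  simp only [community, colorSet, mem_filter, mem_inter, mem_univ, true_and]
  constructor
  · rintro ⟨h1, h2⟩
    exact ⟨⟨h1, h2 ▸ hc⟩, h2⟩
  · rintro ⟨⟨h1, _⟩, h2⟩
    exact ⟨h1, h2⟩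

lemma sum_card_community_inter {n k : ℕ} (σ : Labels n k) (S : Finset (Fin n)) :
    ∑ i, ((community σ i ∩ S).card : ℝ) = S.card := by
  rw [card_eq_sum_card_fiberwise (f := σ) (s := S) (t := univ) (fun _ _ => by simp)]
  push_cast
  refine sum_congr rfl fun i _ => ?_
  congr 2
  ext v
  simp [community, and_comm]

/-- The second clause of `FlatOverlap` is cross-multiplied: its left side is the product of two
community densities, each at most 1, with the difference of the two fractions. -/
lemma flatOverlap_overlap {n k : ℕ} {C : Finset (Fin k)} {r t : ℝ} (ht : 0 ≤ t)
    {σ τ : Labels n k} (hσ : Balanced t σ)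
    (hτ : |((colorSet C τ).card : ℝ) / n - C.card / k| ≤ r + k * t)
    (hf : ∀ i j, fracIn σ (colorSet C τ) i - fracIn σ (colorSet C τ) j ≤ t) :
    FlatOverlap C r t (overlap σ τ) := by
  have hrow : ∀ i, ∑ c, overlap σ τ i c = ((community σ i).card : ℝ) / n :=
    fun i => sum_overlap_right σ τ i
  refine ⟨fun i => ?_, fun i j => ?_, ?_⟩
  · rw [hrow]
    exact hσ i
  · rw [hrow, hrow, sum_overlap_colorSet, sum_overlap_colorSet, ← card_mul_fracIn,
      ← card_mul_fracIn]
    have hle : ∀ i, 0 ≤ ((community σ i).card : ℝ) / n ∧ ((community σ i).card : ℝ) / n ≤ 1 := by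
      intro i
      refine ⟨by positivity, div_le_one_of_le₀ ?_ (by positivity)⟩
      have := card_le_univ (community σ i)
      rw [Fintype.card_fin] at this
      exact_mod_cast this
    have e : ((community σ i).card : ℝ) * fracIn σ (colorSet C τ) i / n
          * (((community σ j).card : ℝ) / n)
        - ((community σ j).card : ℝ) * fracIn σ (colorSet C τ) j / n
          * (((community σ i).card : ℝ) / n)
        = (((community σ i).card : ℝ) / n * (((community σ j).card : ℝ) / n))
          * (fracIn σ (colorSet C τ) i - fracIn σ (colorSet C τ) j) := by ring
    rw [e]
    refine (mul_le_mul_of_nonneg_left (hf i j) (mul_nonneg (hle i).1 (hle j).1)).trans ?_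
    exact mul_le_of_le_one_left ht (mul_le_one₀ (hle i).2 (hle j).1 (hle j).2)
  · simp_rw [sum_overlap_colorSet]
    rwa [← sum_div, sum_card_community_inter]

lemma one_le_tilt {k : ℕ} (hk : 2 ≤ k) : 1 ≤ tilt k := by
  have : (2 : ℝ) ≤ k := by exact_mod_cast hk
  rw [tilt, one_le_div (by linarith)]
  linarith

lemma bParam_nonneg {k : ℕ} (hk : 2 ≤ k) {t : ℝ} (ht : t ≤ 1) : 0 ≤ bParam k t := by
  have : (2 : ℝ) ≤ k := by exact_mod_cast hk
  unfold bParam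
  have h1 : 0 ≤ (k : ℝ) - 1 := by linarith
  have h2 : 0 ≤ 1 - t := by linarith
  positivity

/-- The expected number of colourings `τ` whose set of vertices with colours in `C` is spread evenly
over the communities of `σ`. -/
lemma sum_graphExp_flat_le {n k : ℕ} (hk : 2 ≤ k) {C : Finset (Fin k)} {r s t : ℝ}
    (ht0 : 0 ≤ t) (ht1 : t ≤ 1) (hn : bParam k t ≤ n) (hn0 : 0 < n)
    (hexp : ∀ ν ∈ Set.Icc (0 : Fin k → Fin k → ℝ) 1, FlatOverlap C r t ν → exponent t ν < s)
    (σ : Labels n k) (hσ : Balanced t σ) :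
    ∑ τ : Labels n k, (if |((colorSet C τ).card : ℝ) / n - C.card / k| ≤ r + k * t ∧
        (∀ i j, fracIn σ (colorSet C τ) i - fracIn σ (colorSet C τ) j ≤ t) then
      graphExp (symmMatrix k 0 (bParam k t)) σ (fun G => if Proper G τ ∧
        n * (meanEdges (bParam k t) (overlap σ σ) - t) ≤ edgeCount G then 1 else 0) else 0)
      ≤ (n + 1 : ℝ) ^ (k * k) * Real.exp (s * n) := by
  have hn' : (0 : ℝ) < n := by exact_mod_cast hn0
  -- The mean number of edges depends only on the row sums, that is on σ, so the edge event can be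
  -- stated without reference to τ.
  have hm : ∀ τ : Labels n k, meanEdges (bParam k t) (overlap σ σ)
      = meanEdges (bParam k t) (overlap σ τ) := by
    intro τ
    unfold meanEdges
    simp_rw [sum_overlap_right]
  refine le_trans ?_ (mul_le_mul_of_nonneg_right
    (sum_exp_neg_condEntropy_le hn0 σ) (Real.exp_pos (s * n)).le)
  rw [sum_mul]
  refine sum_le_sum fun τ _ => ?_
  split_ifs with h
  · rw [hm τ]
    refine (graphExp_proper_le (bParam_nonneg hk ht1) hn hn0
      (Real.log_nonneg (one_le_tilt hk)) σ τ).trans ?_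
    rw [Real.exp_log (by linarith [one_le_tilt hk]), exponent_eq hn0, ← Real.exp_add]
    refine Real.exp_le_exp.2 ?_
    have := hexp _ (overlap_mem_Icc σ τ) (flatOverlap_overlap ht0 hσ h.1 h.2)
    unfold exponent at this
    nlinarith
  · positivity

/-- If there are at least `exp (s' n)` candidate colourings and the expected number of those spread
evenly over the communities is at most `exp (s n)`, some set of vertices splits the communities
unevenly with high probability. -/
lemma exists_set_sbmProb_le {n k : ℕ} (hk : 2 ≤ k) {C : Finset (Fin k)} {r s s' t : ℝ}
    (ht0 : 0 ≤ t) (ht1 : t ≤ 1) (hn : bParam k t ≤ n) (hn0 : 0 < n)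
    (hexp : ∀ ν ∈ Set.Icc (0 : Fin k → Fin k → ℝ) 1, FlatOverlap C r t ν → exponent t ν < s) :
    ∃ A : SimpleGraph (Fin n) → Finset (Fin n),
      sbmProb n (uniformDist k) (symmMatrix k 0 (bParam k t)) (fun σ G =>
        (Balanced t σ ∧ Real.exp (s' * n) ≤ (colorings (k := k) C (r + k * t) G).card ∧
          n * (meanEdges (bParam k t) (overlap σ σ) - t) ≤ edgeCount G) ∧
        ∀ i j, fracIn σ (A G) i - fracIn σ (A G) j ≤ t)
      ≤ (n + 1 : ℝ) ^ (k * k) * Real.exp ((s - s') * n) := by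
  have hk0 : k ≠ 0 := by omega
  have hQ := symmMatrix_zero_nonneg (k := k) (bParam_nonneg hk ht1)
  obtain ⟨Ev, hEv⟩ : ∃ Ev : Labels n k → SimpleGraph (Fin n) → Prop, Ev = fun σ G =>
      Balanced t σ ∧ Real.exp (s' * n) ≤ (colorings (k := k) C (r + k * t) G).card ∧
        n * (meanEdges (bParam k t) (overlap σ σ) - t) ≤ edgeCount G := ⟨_, rfl⟩
  obtain ⟨bad, hbad⟩ : ∃ bad : Labels n k → Finset (Fin n) → Prop, bad = fun σ S =>
      ∀ i j, fracIn σ S i - fracIn σ S j ≤ t := ⟨_, rfl⟩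
  obtain ⟨A, hA⟩ := exists_selection (uniformDist_nonneg k) hQ
    (fun G => colorings (k := k) C (r + k * t) G) (colorSet C) bad Ev
    (L := Real.exp (s' * n)) (fun σ G h => by rw [hEv] at h; exact h.2.1)
  refine ⟨A, ?_⟩
  have hsum : ∀ σ : Labels n k, ∑ G : SimpleGraph (Fin n), ∑ τ ∈ colorings (k := k) C (r + k * t) G,
      (if Ev σ G ∧ bad σ (colorSet C τ)
        then sbmWeight (uniformDist k) (symmMatrix k 0 (bParam k t)) σ G else 0)
      ≤ (∏ v, uniformDist k (σ v)) * ((n + 1 : ℝ) ^ (k * k) * Real.exp (s * n)) := by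
    intro σ
    have hp : 0 ≤ ∏ v, uniformDist k (σ v) := prod_nonneg fun _ _ => uniformDist_nonneg _ _
    by_cases hσ : Balanced t σ
    · refine le_trans ?_ (mul_le_mul_of_nonneg_left
        (sum_graphExp_flat_le hk ht0 ht1 hn hn0 hexp σ hσ) hp)
      unfold colorings
      simp_rw [sum_filter]
      rw [sum_comm, mul_sum]
      refine sum_le_sum fun τ _ => ?_
      split_ifs with h
      · unfold graphExp
        rw [mul_sum]
        refine sum_le_sum fun G _ => ?_
        have hw := graphWeight_nonneg hQ σ G
        unfold sbmWeight
        beta_reduce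
        by_cases h1 : (Proper G τ ∧ |((colorSet C τ).card : ℝ) / n - C.card / k| ≤ r + k * t) ∧
            Ev σ G ∧ bad σ (colorSet C τ)
        · have h2 := h1.2.1
          rw [hEv] at h2
          rw [if_pos h1.1, if_pos h1.2, if_pos ⟨h1.1.1, h2.2.2⟩, mul_one]
        · rw [← ite_and, if_neg h1]
          refine mul_nonneg hp (mul_nonneg hw ?_)
          split_ifs <;> norm_num
      · rw [mul_zero]
        refine (sum_eq_zero fun G _ => ?_).le
        rw [← ite_and]
        refine if_neg fun h1 => h ⟨h1.1.2, ?_⟩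
        have := h1.2.2
        rwa [hbad] at this
    · refine le_trans (le_of_eq (sum_eq_zero fun G _ => sum_eq_zero fun τ _ => ?_))
        (mul_nonneg hp (by positivity))
      refine if_neg fun h => hσ ?_
      have := h.1
      rw [hEv] at this
      exact this.1
  have htot := hA.trans (sum_le_sum fun σ _ => hsum σ)
  rw [← sum_mul, sum_labels_weight n (sum_uniformDist hk0), one_mul] at htot
  rw [sub_mul, Real.exp_sub, mul_div_assoc', le_div_iff₀ (Real.exp_pos _), mul_comm]
  subst hEv hbad
  exact htot

lemma tendsto_pow_mul_exp_neg (m : ℕ) {c : ℝ} (hc : c < 0) :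
    Tendsto (fun n : ℕ => (n + 1 : ℝ) ^ m * Real.exp (c * n)) atTop (𝓝 0) := by
  have h1 : Tendsto (fun x : ℝ => x ^ m * Real.exp (-(-c) * x)) atTop (𝓝 0) := by
    have := Real.tendsto_pow_mul_exp_neg_atTop_nhds_zero m
    have h2 := (this.comp (tendsto_id.const_mul_atTop (neg_pos.2 hc))).const_mul (((-c) ^ m)⁻¹)
    rw [mul_zero] at h2
    refine h2.congr fun x => ?_
    have : (-c) ^ m ≠ 0 := pow_ne_zero _ (neg_pos.2 hc).ne'
    simp only [Function.comp, id, mul_pow]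
    rw [← mul_assoc, inv_mul_cancel_left₀ this, ← neg_mul]
  have h2 : Tendsto (fun n : ℕ => (n + 1 : ℝ)) atTop atTop :=
    tendsto_atTop_add_const_right _ _ tendsto_natCast_atTop_atTop
  have h3 := (h1.comp h2).const_mul (Real.exp (-c))
  rw [mul_zero] at h3
  refine h3.congr fun n => ?_
  simp only [Function.comp, neg_neg]
  rw [mul_left_comm, ← Real.exp_add]
  ring_nf

/-- Detection is solvable slightly below the threshold if the exponent of the expected number of
colourings spread evenly over the communities is smaller than that of the number of candidates. -/
theorem detectionSolvable_of_exponent_lt {k : ℕ} (hk : 2 ≤ k) (C : Finset (Fin k)) {r s s' : ℝ}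
    (hs : s < s')
    (hexp : ∀ ν : Fin k → Fin k → ℝ, (∀ i c, 0 ≤ ν i c) → (∀ i, ∑ c, ν i c = 1 / k) →
      (∀ i j, ∑ c ∈ C, ν i c = ∑ c ∈ C, ν j c) →
      |∑ i, ∑ c ∈ C, ν i c - C.card / k| ≤ r → exponent 0 ν < s)
    (hcount : ∀ᶠ t in 𝓝[>] (0 : ℝ), Tendsto (fun n => sbmProb n (uniformDist k)
      (symmMatrix k 0 (bParam k t)) (fun σ G => Balanced t σ ∧
        ((colorings (k := k) C (r + k * t) G).card : ℝ) < Real.exp (s' * n))) atTop (𝓝 0)) :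
    ∀ᶠ t in 𝓝[>] (0 : ℝ), DetectionSolvable k 0 (bParam k t) := by
  have hk0 : k ≠ 0 := by omega
  filter_upwards [hcount, nhdsWithin_le_nhds (eventually_exponent_lt hexp),
    Ioo_mem_nhdsGT (show (0 : ℝ) < 1 from one_pos)] with t hc hexp ht
  obtain ⟨ht0, ht1⟩ := ht
  set b := bParam k t with hb
  have hb0 : 0 ≤ b := bParam_nonneg hk ht1.le
  have hQ := symmMatrix_zero_nonneg (k := k) hb0
  have hp := uniformDist_nonneg k
  have hp1 := sum_uniformDist hk0
  have hlarge : ∀ᶠ n : ℕ in atTop, b ≤ n ∧ 0 < n :=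
    (tendsto_natCast_atTop_atTop.eventually_ge_atTop b).and (eventually_gt_atTop 0)
  have hex : ∀ n : ℕ, ∃ A : SimpleGraph (Fin n) → Finset (Fin n), (b ≤ n ∧ 0 < n) →
      sbmProb n (uniformDist k) (symmMatrix k 0 b) (fun σ G =>
        (Balanced t σ ∧ Real.exp (s' * n) ≤ (colorings (k := k) C (r + k * t) G).card ∧
          n * (meanEdges b (overlap σ σ) - t) ≤ edgeCount G) ∧
        ∀ i j, fracIn σ (A G) i - fracIn σ (A G) j ≤ t)
      ≤ (n + 1 : ℝ) ^ (k * k) * Real.exp ((s - s') * n) := by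
    intro n
    by_cases hn : b ≤ n ∧ 0 < n
    · obtain ⟨A, hA⟩ := exists_set_sbmProb_le (s' := s') hk ht0.le ht1.le hn.1 hn.2 hexp
      exact ⟨A, fun _ => hA⟩
    · exact ⟨fun _ => ∅, fun h => absurd h hn⟩
  choose A hA using hex
  -- The same t serves as distance from the threshold, tolerance of all estimates and detection
  -- margin. Failure forces one of four negligible events: σ unbalanced, too few candidates, too few
  -- edges, or a flat output although the other three are absent.
  refine ⟨A, t, ht0, tendsto_sbmProb_one hp1 ?_⟩
  have hflat : Tendsto (fun n => sbmProb n (uniformDist k) (symmMatrix k 0 b) (fun σ G =>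
        (Balanced t σ ∧ Real.exp (s' * n) ≤ (colorings (k := k) C (r + k * t) G).card ∧
          n * (meanEdges b (overlap σ σ) - t) ≤ edgeCount G) ∧
        ∀ i j, fracIn σ (A n G) i - fracIn σ (A n G) j ≤ t)) atTop (𝓝 0) := by
    refine tendsto_of_tendsto_of_tendsto_of_le_of_le' tendsto_const_nhds
      (tendsto_pow_mul_exp_neg (k * k) (sub_neg.2 hs))
      (Eventually.of_forall fun n => sbmProb_nonneg hp hQ _) ?_
    filter_upwards [hlarge] with n hn using hA n hn
  have hedge : Tendsto (fun n => sbmProb n (uniformDist k) (symmMatrix k 0 b) (fun σ G =>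
      True ∧ edgeCount G < n * (meanEdges b (overlap σ σ) - t))) atTop (𝓝 0) := by
    refine tendsto_of_tendsto_of_tendsto_of_le_of_le' tendsto_const_nhds
      (tendsto_const_div_atTop_nhds_zero_nat (b / t ^ 2))
      (Eventually.of_forall fun n => sbmProb_nonneg hp hQ _) ?_
    filter_upwards [hlarge] with n hn
    exact sbmProb_and_le hp hp1 (by positivity) fun σ _ =>
      graphExp_edgeCount_lt_le hb0 hn.1 hn.2 ht0 σ σ
  refine tendsto_sbmProb_zero_of_imp_or hp hQ
    (E := fun n σ G => ¬ Balanced t σ ∨ ((Balanced t σ ∧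
        ((colorings (k := k) C (r + k * t) G).card : ℝ) < Real.exp (s' * n))))
    (tendsto_sbmProb_zero_of_imp_or hp hQ (tendsto_sbmProb_not_balanced hk0 hQ ht0) hc
      (Eventually.of_forall fun n σ G h => h))
    (tendsto_sbmProb_zero_of_imp_or hp hQ hflat hedge
      (Eventually.of_forall fun n σ G h => h))
    (Eventually.of_forall fun n σ G h => ?_)
  by_contra! hcon
  obtain ⟨⟨h1, h2⟩, h3, h4⟩ := hcon
  push Not at h
  obtain ⟨i, j, hij⟩ := h3 ⟨h1, h2 h1, h4 trivial⟩
  exact absurd hij (not_lt.2 (h i j))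

/-! ### Entropy inequalities -/

lemma two_mul_log_le_sub_inv {z : ℝ} (hz : 1 ≤ z) : 2 * Real.log z ≤ z - z⁻¹ := by
  have h0 : 0 < z := by linarith
  have := Real.self_le_sinh_iff.2 (Real.log_nonneg hz)
  rw [Real.sinh_eq, Real.exp_neg, Real.exp_log h0] at this
  linarith

/-- This is u ≤ sinh u at u = log(1/√x), multiplied by x. -/
lemma negMulLog_le_sqrt_mul {x : ℝ} (h0 : 0 ≤ x) (h1 : x ≤ 1) :
    Real.negMulLog x ≤ √x * (1 - x) := by
  rcases h0.eq_or_lt with rfl | h0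
  · simp
  · have hs : 0 < √x := Real.sqrt_pos.2 h0
    have hs1 : √x ≤ 1 := Real.sqrt_le_one.2 h1
    have h := two_mul_log_le_sub_inv ((one_le_inv₀ hs).2 hs1)
    rw [Real.log_inv, inv_inv, Real.log_sqrt h0.le] at h
    have h2 : √x * √x = x := Real.mul_self_sqrt h0.le
    have h3 := mul_le_mul_of_nonneg_left h h0.le
    have h4 : x * ((√x)⁻¹ - √x) = √x * (1 - x) := by
      have : x * (√x)⁻¹ = √x := by
        rw [mul_inv_eq_iff_eq_mul₀ hs.ne', h2]
      rw [mul_sub, this]; ring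
    rw [h4] at h3
    rw [Real.negMulLog]
    linarith

/-- The function `-x log x + l x ^ 2` on the unit interval lies below a chord-like line through
its value at `1`. -/
lemma negMulLog_add_sq_le {x l : ℝ} (h0 : 0 ≤ x) (h1 : x ≤ 1) (hl : 0 < l) :
    Real.negMulLog x + l * x ^ 2 ≤ (l - 1 / (4 * l)) * x + 1 / (4 * l) := by
  have h := negMulLog_le_sqrt_mul h0 h1
  have h2 : √x * √x = x := Real.mul_self_sqrt h0
  -- The inequality of arithmetic and geometric means, chosen so that the quadratic terms cancel and
  -- a linear bound remains.
  have h3 : √x ≤ l * x + 1 / (4 * l) := by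
    have e : l * x + 1 / (4 * l) - √x = (2 * l * √x - 1) ^ 2 / (4 * l) := by
      have : (2 * l * √x - 1) ^ 2 = 4 * l ^ 2 * x - 4 * l * √x + 1 := by
        linear_combination (4 * l ^ 2) * h2
      rw [this]
      field_simp
      ring
    have : 0 ≤ (2 * l * √x - 1) ^ 2 / (4 * l) := by positivity
    linarith
  have h4 := mul_le_mul_of_nonneg_right h3 (sub_nonneg.2 h1)
  nlinarith

/-- Dividing the block by its sum s reduces to the unit interval with l = γs. The bound is the value
with all mass on a single entry plus 1/(4γ) for each further entry. -/
lemma sum_negMulLog_add_sq_le {ι : Type*} (A : Finset ι) (p : ι → ℝ) (hp : ∀ c ∈ A, 0 ≤ p c)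
    {γ : ℝ} (hγ : 0 < γ) (hs : 0 < ∑ c ∈ A, p c) :
    ∑ c ∈ A, (Real.negMulLog (p c) + γ * p c ^ 2) ≤ Real.negMulLog (∑ c ∈ A, p c)
      + γ * (∑ c ∈ A, p c) ^ 2 + (A.card - 1) / (4 * γ) := by
  set s := ∑ c ∈ A, p c with hsd
  have hc : ∀ c ∈ A, Real.negMulLog (p c) + γ * p c ^ 2
      ≤ p c / s * Real.negMulLog s + s * ((γ * s - 1 / (4 * (γ * s))) * (p c / s)
        + 1 / (4 * (γ * s))) := by
    intro c hcA
    have hq1 : p c / s ≤ 1 := (div_le_one hs).2 (single_le_sum hp hcA)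
    have hq0 : 0 ≤ p c / s := div_nonneg (hp c hcA) hs.le
    have h := negMulLog_add_sq_le hq0 hq1 (mul_pos hγ hs)
    have e : p c = s * (p c / s) := by field_simp
    have e1 : Real.negMulLog (p c) = p c / s * Real.negMulLog s + s * Real.negMulLog (p c / s) := by
      conv_lhs => rw [e]
      exact Real.negMulLog_mul _ _
    have h' := mul_le_mul_of_nonneg_left h hs.le
    rw [e1]
    have e2 : γ * p c ^ 2 = s * (γ * s * (p c / s) ^ 2) := by field_simp
    rw [e2]
    linarith
  refine (sum_le_sum hc).trans (le_of_eq ?_)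
  simp_rw [mul_add, sum_add_distrib, ← mul_assoc]
  rw [← sum_mul, ← mul_sum, ← sum_div, ← hsd, sum_const, nsmul_eq_mul, div_self hs.ne']
  field_simp
  ring

lemma log_ratio_ge {y : ℝ} (h0 : 0 ≤ y) (h1 : y < 1) :
    2 * y + 2 / 3 * y ^ 3 ≤ Real.log (1 + y) - Real.log (1 - y) := by
  have h := Real.hasSum_log_sub_log_of_abs_lt_one (x := y) (by rwa [abs_of_nonneg h0])
  have := sum_le_hasSum (range 2) (fun i _ => by positivity) h
  simp [sum_range_succ] at this
  linarith

/-- A fourth order upper bound for the binary entropy. -/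
lemma binary_entropy_le {y : ℝ} (h0 : -1 ≤ y) (h1 : y ≤ 1) :
    Real.negMulLog ((1 + y) / 2) + Real.negMulLog ((1 - y) / 2)
      ≤ Real.log 2 - y ^ 2 / 2 - y ^ 4 / 12 := by
  wlog hy : 0 ≤ y generalizing y
  · have := this (y := -y) (by linarith) (by linarith) (by linarith)
    rw [sub_neg_eq_add, ← sub_eq_add_neg, even_two.neg_pow,
      (show Even 4 by decide).neg_pow] at this
    linarith
  -- Twice the gap in the inequality; it vanishes at 0, and its derivative is nonnegative by two
  -- terms of the series for log((1+y)/(1-y)).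
  set f : ℝ → ℝ := fun y => -Real.negMulLog (1 + y) - Real.negMulLog (1 - y) - y ^ 2 - y ^ 4 / 6
    with hf
  have hcont : Continuous f := by
    have := Real.continuous_negMulLog
    fun_prop
  have hder : ∀ x ∈ interior (Set.Icc (0 : ℝ) 1), HasDerivAt f
      (Real.log (1 + x) - Real.log (1 - x) - 2 * x - 2 / 3 * x ^ 3) x := by
    intro x hx
    rw [interior_Icc] at hx
    have a1 : HasDerivAt (fun y : ℝ => 1 + y) 1 x := (hasDerivAt_id x).const_add 1
    have a2 : HasDerivAt (fun y : ℝ => 1 - y) (-1) x := (hasDerivAt_id x).const_sub 1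
    have b1 := (Real.hasDerivAt_negMulLog (x := 1 + x) (by linarith [hx.1])).comp x a1
    have b2 := (Real.hasDerivAt_negMulLog (x := 1 - x) (by linarith [hx.2])).comp x a2
    have := ((b1.neg.sub b2).sub (hasDerivAt_pow 2 x)).sub ((hasDerivAt_pow 4 x).div_const 6)
    refine this.congr_deriv ?_
    norm_num
    ring
  have hmono : MonotoneOn f (Set.Icc 0 1) := by
    refine monotoneOn_of_deriv_nonneg (convex_Icc 0 1) hcont.continuousOn
      (fun x hx => (hder x hx).differentiableAt.differentiableWithinAt) fun x hx => ?_
    rw [(hder x hx).deriv]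
    rw [interior_Icc] at hx
    have := log_ratio_ge hx.1.le hx.2
    linarith
  have h := hmono (Set.left_mem_Icc.2 zero_le_one) (Set.mem_Icc.2 ⟨hy, h1⟩) hy
  have e : ∀ z : ℝ, Real.negMulLog (z / 2) = (Real.negMulLog z + z * Real.log 2) / 2 := by
    intro z
    rw [div_eq_mul_inv, Real.negMulLog_mul]
    simp only [Real.negMulLog, Real.log_inv]
    ring
  rw [e, e]
  simp only [hf, add_zero, sub_zero, Real.negMulLog_one] at h
  norm_num at h
  linarith

lemma log_tilt_ge {k : ℕ} (hk : 2 ≤ k) :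
    1 / (k : ℝ) + (1 / (k : ℝ)) ^ 2 / 2 + (1 / (k : ℝ)) ^ 3 / 3 ≤ Real.log (tilt k) := by
  have hk' : (2 : ℝ) ≤ k := by exact_mod_cast hk
  have hk0 : (0 : ℝ) < k := by linarith
  have hlt : |1 / (k : ℝ)| < 1 := by
    rw [abs_of_pos (by positivity), div_lt_one hk0]
    linarith
  have h := Real.hasSum_pow_div_log_of_abs_lt_one hlt
  have := sum_le_hasSum (range 3) (fun i _ => by positivity) h
  have e : -Real.log (1 - 1 / (k : ℝ)) = Real.log (tilt k) := by
    rw [← Real.log_inv, tilt]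
    congr 1
    have : (k : ℝ) - 1 ≠ 0 := by linarith
    field_simp
  rw [e] at this
  simp only [sum_range_succ, range_zero, sum_empty] at this
  norm_num at this ⊢
  linarith

/-- The exponent at the threshold for overlaps with equal row sums. -/
lemma exponent_zero_eq {k : ℕ} (hk : 2 ≤ k) (ν : Fin k → Fin k → ℝ)
    (h : ∀ i, ∑ c, ν i c = 1 / k) :
    exponent 0 ν = ∑ i, ∑ c, (Real.negMulLog (ν i c) + k ^ 2 / 2 * ν i c ^ 2) - Real.log k
      + (k - 1) / 2 - k ^ 2 / 2 * ∑ c, (∑ i, ν i c) ^ 2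
      - (k - 1) ^ 2 / 2 * Real.log (tilt k) := by
  have hk' : (2 : ℝ) ≤ k := by exact_mod_cast hk
  have hk0 : (k : ℝ) ≠ 0 := by linarith
  have hk1 : (k : ℝ) - 1 ≠ 0 := by linarith
  unfold exponent condEntropy energy meanEdges bParam
  simp_rw [h, sum_add_distrib, ← mul_sum]
  simp only [sum_const, card_univ, Fintype.card_fin, nsmul_eq_mul]
  have e1 : (k : ℝ) * Real.negMulLog (1 / k) = Real.log k := by
    rw [Real.negMulLog, one_div, Real.log_inv]
    field_simp
  rw [e1]
  generalize ∑ i, ∑ c, ν i c ^ 2 = X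
  generalize ∑ c, (∑ i, ν i c) ^ 2 = Y
  generalize ∑ i, ∑ c, Real.negMulLog (ν i c) = Z
  generalize Real.log (tilt k) = l
  unfold tilt
  field_simp
  ring

/-- Cauchy–Schwarz for the k column sums, whose total is 1. -/
lemma sum_sq_column_ge {k : ℕ} (hk : k ≠ 0) (ν : Fin k → Fin k → ℝ)
    (h : ∀ i, ∑ c, ν i c = 1 / k) : 1 / (k : ℝ) ≤ ∑ c, (∑ i, ν i c) ^ 2 := by
  have hk0 : (0 : ℝ) < k := by positivity
  have h1 : ∑ c, ∑ i, ν i c = 1 := by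
    rw [sum_comm]
    simp_rw [h]
    simp only [sum_const, card_univ, Fintype.card_fin, nsmul_eq_mul]
    field_simp
  have := sq_sum_le_card_mul_sum_sq (s := univ) (f := fun c => ∑ i, ν i c)
  rw [h1, card_univ, Fintype.card_fin] at this
  rw [div_le_iff₀ hk0]
  linarith

/-! ### At least five communities -/

/-- For at least five communities the expected number of colourings that spread two colours evenly
over the communities is exponentially small. -/
lemma exponent_zero_lt_of_five_le {k : ℕ} (hk : 5 ≤ k) {C : Finset (Fin k)} (hC : C.card = 2)
    (ν : Fin k → Fin k → ℝ) (h0 : ∀ i c, 0 ≤ ν i c) (h1 : ∀ i, ∑ c, ν i c = 1 / k)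
    (h2 : ∀ i j, ∑ c ∈ C, ν i c = ∑ c ∈ C, ν j c)
    (h3 : |∑ i, ∑ c ∈ C, ν i c - C.card / k| ≤ 0) : exponent 0 ν < -1 / 200 := by
  have hk' : (5 : ℝ) ≤ k := by exact_mod_cast hk
  have hk0 : (0 : ℝ) < k := by linarith
  have hC1 : ∀ i, ∑ c ∈ C, ν i c = 2 / k ^ 2 := by
    intro i
    have e := sub_eq_zero.1 (abs_nonpos_iff.1 h3)
    rw [sum_congr rfl fun j _ => h2 j i, hC] at e
    simp only [sum_const, card_univ, Fintype.card_fin, nsmul_eq_mul] at e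
    push_cast at e
    field_simp at e ⊢
    linarith
  have hC2 : ∀ i, ∑ c ∈ Cᶜ, ν i c = (k - 2) / k ^ 2 := by
    intro i
    have := sum_add_sum_compl C (ν i)
    rw [h1, hC1] at this
    field_simp at this ⊢
    linarith
  have hCc : ((Cᶜ).card : ℝ) = k - 2 := by
    rw [card_compl, Fintype.card_fin, hC, Nat.cast_sub (by omega)]
    norm_num
  -- Flatness fixes only the mass of each row in the blocks C and Cᶜ; inside the blocks the row is
  -- arbitrary and the block inequality is applied with γ = k²/2.
  have hrow : ∀ i, ∑ c, (Real.negMulLog (ν i c) + k ^ 2 / 2 * ν i c ^ 2)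
      ≤ Real.negMulLog (2 / k ^ 2) + k ^ 2 / 2 * (2 / k ^ 2) ^ 2 + 1 / (4 * (k ^ 2 / 2))
        + (Real.negMulLog ((k - 2) / k ^ 2) + k ^ 2 / 2 * ((k - 2) / k ^ 2) ^ 2
          + (k - 3) / (4 * (k ^ 2 / 2))) := by
    intro i
    have a1 := sum_negMulLog_add_sq_le C (ν i) (fun c _ => h0 i c) (γ := k ^ 2 / 2)
      (by positivity) (by rw [hC1]; positivity)
    have a2 := sum_negMulLog_add_sq_le Cᶜ (ν i) (fun c _ => h0 i c) (γ := k ^ 2 / 2)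
      (by positivity) (by rw [hC2]; exact div_pos (by linarith) (by positivity))
    rw [hC1, hC] at a1
    rw [hC2, hCc] at a2
    rw [← sum_add_sum_compl C]
    refine (add_le_add a1 a2).trans (le_of_eq ?_)
    push_cast
    ring
  have hent : k * (Real.negMulLog (2 / k ^ 2) + Real.negMulLog ((k - 2) / k ^ 2)) - Real.log k
      ≤ Real.log 2 - (1 - 4 / k) ^ 2 / 2 := by
    have e : ∀ x : ℝ, k * Real.negMulLog (x / k ^ 2) = Real.negMulLog (x / k)
        + x / k * Real.log k := by
      intro x
      have : x / (k : ℝ) ^ 2 = x / k * (k : ℝ)⁻¹ := by field_simp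
      rw [this, Real.negMulLog_mul]
      simp only [Real.negMulLog, Real.log_inv]
      field_simp
    -- The choice y = 1 - 4/k turns (1 ∓ y)/2 into the block masses 2/k and (k-2)/k; the quartic
    -- gain is not needed here.
    have hlt : 4 / (k : ℝ) ≤ 1 := (div_le_one hk0).2 (by linarith)
    have hpos : 0 < 4 / (k : ℝ) := by positivity
    have hb := binary_entropy_le (y := 1 - 4 / k) (by linarith) (by linarith)
    have e1 : (1 + (1 - 4 / (k : ℝ))) / 2 = (k - 2) / k := by field_simp; ring
    have e2 : (1 - (1 - 4 / (k : ℝ))) / 2 = 2 / k := by field_simp; ring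
    rw [e1, e2] at hb
    rw [mul_add, e, e]
    have e3 : 2 / (k : ℝ) * Real.log k + (k - 2) / k * Real.log k = Real.log k := by
      field_simp; ring
    have : 0 ≤ (1 - 4 / (k : ℝ)) ^ 4 := by positivity
    linarith
  have hsum := sum_le_sum fun i (_ : i ∈ univ) => hrow i
  rw [sum_const, card_univ, Fintype.card_fin, nsmul_eq_mul] at hsum
  have hcol := mul_le_mul_of_nonneg_left (sum_sq_column_ge (by omega) ν h1)
    (show (0 : ℝ) ≤ k ^ 2 / 2 by positivity)
  have hlog := mul_le_mul_of_nonneg_left (log_tilt_ge (k := k) (by omega))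
    (show (0 : ℝ) ≤ (k - 1) ^ 2 / 2 by positivity)
  rw [exponent_zero_eq (by omega) ν h1]
  obtain ⟨y, hy⟩ : ∃ y : ℝ, y = 1 / k := ⟨_, rfl⟩
  have hy0 : 0 < y := by rw [hy]; positivity
  have hy5 : y ≤ 1 / 5 := by
    rw [hy]
    exact one_div_le_one_div_of_le (by norm_num) hk'
  have hl2 := Real.log_two_lt_d9
  -- In y = 1/k the bound is largest at y = 1/5, where it is about -0.008. At y = 1/4 it would be
  -- positive, which is why four communities need a separate argument.
  have hpoly : Real.log 2 - 7 / 4 + 7 * y - 33 / 4 * y ^ 2 - y / 6 * (1 - y) ^ 2 < -1 / 200 := by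
    nlinarith [mul_nonneg hy0.le (sub_nonneg.2 hy5), mul_nonneg (mul_nonneg hy0.le hy0.le)
      (sub_nonneg.2 hy5)]
  have e1 : (k : ℝ) * (k ^ 2 / 2 * (2 / k ^ 2) ^ 2 + 1 / (4 * (k ^ 2 / 2))
        + (k ^ 2 / 2 * ((k - 2) / k ^ 2) ^ 2 + (k - 3) / (4 * (k ^ 2 / 2))))
      + (k - 1) / 2 - k ^ 2 / 2 * (1 / k) - (k - 1) ^ 2 / 2 * (1 / (k : ℝ) + (1 / (k : ℝ)) ^ 2 / 2
        + (1 / (k : ℝ)) ^ 3 / 3) - (1 - 4 / k) ^ 2 / 2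
      = - 7 / 4 + 7 * y - 33 / 4 * y ^ 2 - y / 6 * (1 - y) ^ 2 := by
    rw [hy]
    field_simp
    ring
  linarith

/-! ### Four communities: the exponent -/

/-- With p, q = w(1 ± y)/2, the coefficient of y² is w(4w - 1/2), which changes sign at w = 1/8, the
mass of a colour pair in a row of the uniform overlap. Beyond that point the quartic term of the
binary entropy limits the gain from an uneven split. -/
lemma negMulLog_pair_le {p q : ℝ} (hp : 0 ≤ p) (hq : 0 ≤ q) :
    Real.negMulLog p + Real.negMulLog q + 8 * (p ^ 2 + q ^ 2) ≤ Real.negMulLog (p + q)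
      + (p + q) * Real.log 2 + 4 * (p + q) ^ 2
      + 3 * (p + q) * max 0 (4 * (p + q) - 1 / 2) ^ 2 := by
  set w := p + q with hw
  rcases (add_nonneg hp hq).eq_or_lt with h | h
  · have h1 : p = 0 := by linarith
    have h2 : q = 0 := by linarith
    have h3 : w = 0 := by linarith
    simp [h1, h2, h3]
  · set y := (p - q) / w with hy
    have hwy : w * y = p - q := by rw [hy]; exact mul_div_cancel₀ _ h.ne'
    have ep : p = w * ((1 + y) / 2) := by linarith
    have eq' : q = w * ((1 - y) / 2) := by linarith
    have hy1 : y ≤ 1 := by rw [hy, div_le_one h]; linarith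
    have hy0 : -1 ≤ y := by rw [hy, le_div_iff₀ h]; linarith
    have hb := mul_le_mul_of_nonneg_left (binary_entropy_le hy0 hy1) h.le
    have e1 : Real.negMulLog p + Real.negMulLog q = Real.negMulLog w
        + w * (Real.negMulLog ((1 + y) / 2) + Real.negMulLog ((1 - y) / 2)) := by
      conv_lhs => rw [ep, eq', Real.negMulLog_mul, Real.negMulLog_mul]
      ring
    have e2 : 8 * (p ^ 2 + q ^ 2) = 4 * w ^ 2 + 4 * w ^ 2 * y ^ 2 := by
      conv_lhs => rw [ep, eq']
      ring
    -- For m = max(0, 4w - 1/2) the expression m y² - y⁴/12 has its maximum 3m² at y² = 6m.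
    have e3 : y ^ 2 * (4 * w - 1 / 2) - y ^ 4 / 12 ≤ 3 * max 0 (4 * w - 1 / 2) ^ 2 := by
      have hm := mul_le_mul_of_nonneg_left (le_max_right 0 (4 * w - 1 / 2)) (sq_nonneg y)
      nlinarith [sq_nonneg (y ^ 2 - 6 * max 0 (4 * w - 1 / 2))]
    have e4 := mul_le_mul_of_nonneg_left e3 h.le
    rw [e1, e2]
    nlinarith

/-- For four communities the exponent of the expected number of colourings that spread two colours
evenly over the communities is largest if all colours are spread evenly. -/
lemma exponent_zero_four_le (ν : Fin 4 → Fin 4 → ℝ) (h0 : ∀ i c, 0 ≤ ν i c)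
    (h1 : ∀ i, ∑ c, ν i c = 1 / 4)
    (h2 : ∀ i j, ∑ c ∈ ({0, 1} : Finset (Fin 4)), ν i c = ∑ c ∈ ({0, 1} : Finset (Fin 4)), ν j c) :
    exponent 0 ν ≤ 2 * Real.log 2 - 9 / 2 * Real.log (4 / 3) := by
  obtain ⟨w, hw⟩ : ∃ w, ∀ i, ν i 0 + ν i 1 = w := by
    refine ⟨ν 0 0 + ν 0 1, fun i => ?_⟩
    have := h2 i 0
    rwa [sum_pair (by decide), sum_pair (by decide)] at this
  have hw' : ∀ i, ν i 2 + ν i 3 = 1 / 4 - w := by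
    intro i
    have := h1 i
    rw [Fin.sum_univ_four] at this
    linarith [hw i]
  set u := 4 * w - 1 / 2 with hu
  have hw0 : 0 ≤ w := by linarith [hw 0, h0 0 0, h0 0 1]
  have hw1 : w ≤ 1 / 4 := by linarith [hw' 0, h0 0 2, h0 0 3]
  have hrow : ∀ i, ∑ c, (Real.negMulLog (ν i c) + 8 * ν i c ^ 2)
      ≤ Real.negMulLog w + Real.negMulLog (1 / 4 - w) + 1 / 4 * Real.log 2
        + 4 * (w ^ 2 + (1 / 4 - w) ^ 2) + 3 / 4 * u ^ 2 := by
    intro i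
    have a1 := negMulLog_pair_le (h0 i 0) (h0 i 1)
    have a2 := negMulLog_pair_le (h0 i 2) (h0 i 3)
    rw [hw] at a1
    rw [hw', show 4 * (1 / 4 - w) - 1 / 2 = -u by rw [hu]; ring] at a2
    rw [← hu] at a1
    -- The two pairs deviate by u and -u, so at most one of them has a positive correction.
    have a3 : 3 * w * max 0 u ^ 2 + 3 * (1 / 4 - w) * max 0 (-u) ^ 2 ≤ 3 / 4 * u ^ 2 := by
      rcases le_total 0 u with h | h
      · rw [max_eq_right h, max_eq_left (by linarith)]
        nlinarith [sq_nonneg u]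
      · rw [max_eq_left h, max_eq_right (by linarith)]
        nlinarith [sq_nonneg u]
    rw [Fin.sum_univ_four]
    linarith
  have hsum := sum_le_sum fun i (_ : i ∈ univ) => hrow i
  rw [sum_const, card_univ, Fintype.card_fin, nsmul_eq_mul] at hsum
  have hcol : 1 / 4 + u ^ 2 ≤ ∑ c, (∑ i, ν i c) ^ 2 := by
    rw [Fin.sum_univ_four]
    have b1 : ∑ i, ν i 0 + ∑ i, ν i 1 = 1 / 2 + u := by
      rw [← sum_add_distrib, sum_congr rfl fun i _ => hw i]
      simp [hu]
    have b2 : ∑ i, ν i 2 + ∑ i, ν i 3 = 1 / 2 - u := by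
      rw [← sum_add_distrib, sum_congr rfl fun i _ => hw' i]
      simp [hu]
      ring
    nlinarith [sq_nonneg (∑ i, ν i 0 - ∑ i, ν i 1), sq_nonneg (∑ i, ν i 2 - ∑ i, ν i 3)]
  have hent : 4 * (Real.negMulLog w + Real.negMulLog (1 / 4 - w))
      ≤ 3 * Real.log 2 - 2 * u ^ 2 := by
    have e : ∀ x : ℝ, 4 * Real.negMulLog (x * (1 / 4)) = Real.negMulLog x + 2 * x * Real.log 2 := by
      intro x
      rw [Real.negMulLog_mul]
      have : Real.log (1 / 4) = -(2 * Real.log 2) := by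
        rw [one_div, Real.log_inv, show (4 : ℝ) = 2 ^ 2 by norm_num, Real.log_pow]
        norm_num
      simp only [Real.negMulLog, this]
      ring
    have hb := binary_entropy_le (y := 2 * u) (by linarith) (by linarith)
    have c1 : w = (1 + 2 * u) / 2 * (1 / 4) := by rw [hu]; ring
    have c2 : 1 / 4 - w = (1 - 2 * u) / 2 * (1 / 4) := by rw [hu]; ring
    rw [mul_add, c2, e, c1, e]
    nlinarith [sq_nonneg (u ^ 2)]
  have h1' : ∀ i, ∑ c, ν i c = 1 / ((4 : ℕ) : ℝ) := by
    intro i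
    rw [h1]
    norm_num
  have hlog4 : Real.log ((4 : ℕ) : ℝ) = 2 * Real.log 2 := by
    rw [show ((4 : ℕ) : ℝ) = 2 ^ 2 by norm_num, Real.log_pow]
    norm_num
  have htilt : tilt 4 = 4 / 3 := by
    unfold tilt
    norm_num
  rw [exponent_zero_eq (by norm_num) ν h1', hlog4, htilt]
  norm_num at hsum ⊢
  -- The coefficients of u² are -2 from the entropy of the pair masses, +2 from the squares, +3 from
  -- the corrections and -8 from the column sums. Their total -5 makes u = 0 the worst case.
  have e5 : 16 * (w ^ 2 + (1 / 4 - w) ^ 2) = 1 / 2 + 2 * u ^ 2 := by rw [hu]; ring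
  nlinarith [sq_nonneg u]

lemma four_threshold_lt : 2 * Real.log 2 - 9 / 2 * Real.log (4 / 3) < 0.0918 := by
  have h : Real.log (4 / 3) = 2 * Real.log 2 - Real.log 3 := by
    rw [Real.log_div (by norm_num) (by norm_num), show (4 : ℝ) = 2 ^ 2 by norm_num, Real.log_pow]
    norm_num
  rw [h]
  linarith [Real.log_two_gt_d9, Real.log_three_lt_d9]

/-! ### Independent sets -/

/-- A random set contains both members of a pair with probability 1/4. The degenerate pair (a, a)
forbids the single element a, with probability 1/2. -/
lemma card_not_mem_pair {α : Type*} [Fintype α] [DecidableEq α] (e : α × α) :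
    (2 : ℝ) ^ Fintype.card α * (if e.1 = e.2 then 1 / 2 else 3 / 4)
      = ((univ.filter fun x : Finset α => ¬ (e.1 ∈ x ∧ e.2 ∈ x)).card : ℝ) := by
  have h1 : (univ.filter fun x : Finset α => e.1 ∈ x ∧ e.2 ∈ x) = Icc {e.1, e.2} univ := by
    ext x
    simp [insert_subset_iff]
  have h2 := card_filter_add_card_filter_not (s := (univ : Finset (Finset α)))
    (fun x => e.1 ∈ x ∧ e.2 ∈ x)
  rw [h1, card_Icc_finset (subset_univ _), card_univ, card_univ, Fintype.card_finset] at h2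
  have h3 : ((univ.filter fun x : Finset α => ¬ (e.1 ∈ x ∧ e.2 ∈ x)).card : ℝ)
      = 2 ^ Fintype.card α - 2 ^ (Fintype.card α - ({e.1, e.2} : Finset α).card) := by
    rw [eq_sub_iff_add_eq, add_comm]
    exact_mod_cast h2
  rw [h3]
  have hle : ({e.1, e.2} : Finset α).card ≤ Fintype.card α := card_le_univ _
  rw [pow_sub₀ (2 : ℝ) two_ne_zero hle]
  split_ifs with he
  · simp [he]
    ring
  · rw [card_pair he]
    ring

/-- Avoiding finitely many pairs in a random set are positively correlated events. -/
lemma card_avoiding_ge {α : Type*} [Fintype α] [DecidableEq α] (P : Finset (α × α)) :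
    (2 : ℝ) ^ Fintype.card α * ∏ e ∈ P, (if e.1 = e.2 then 1 / 2 else 3 / 4)
      ≤ ((univ.filter fun x : Finset α => ∀ e ∈ P, ¬ (e.1 ∈ x ∧ e.2 ∈ x)).card : ℝ) := by
  induction P using Finset.induction_on with
  | empty => simp
  | insert a P ha ih =>
    set 𝒜 := univ.filter fun x : Finset α => ¬ (a.1 ∈ x ∧ a.2 ∈ x) with hA
    set ℬ := univ.filter fun x : Finset α => ∀ e ∈ P, ¬ (e.1 ∈ x ∧ e.2 ∈ x) with hB
    have h1 : IsLowerSet (𝒜 : Set (Finset α)) := by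
      intro x y hxy hx
      simp only [hA, coe_filter, mem_univ, true_and, Set.mem_ofPred_eq] at hx ⊢
      exact fun h => hx ⟨hxy h.1, hxy h.2⟩
    have h2 : IsLowerSet (ℬ : Set (Finset α)) := by
      intro x y hxy hx
      simp only [hB, coe_filter, mem_univ, true_and, Set.mem_ofPred_eq] at hx ⊢
      exact fun e he h => hx e he ⟨hxy h.1, hxy h.2⟩
    -- Kleitman's inequality for the two lower sets, an instance of Harris's correlation inequality.
    have h3 := h1.le_card_inter_finset h2
    have h4 : 𝒜 ∩ ℬ = univ.filter fun x : Finset α => ∀ e ∈ insert a P, ¬ (e.1 ∈ x ∧ e.2 ∈ x) := by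
      ext x
      simp [hA, hB]
    rw [h4] at h3
    have h5 : (𝒜.card : ℝ) * ℬ.card ≤ 2 ^ Fintype.card α * ((univ.filter fun x : Finset α =>
        ∀ e ∈ insert a P, ¬ (e.1 ∈ x ∧ e.2 ∈ x)).card : ℝ) := by exact_mod_cast h3
    rw [← card_not_mem_pair a, mul_assoc] at h5
    have h6 := le_of_mul_le_mul_left h5 (by positivity)
    rw [prod_insert ha]
    refine le_trans ?_ h6
    rw [mul_left_comm]
    refine mul_le_mul_of_nonneg_left ih ?_
    split_ifs <;> norm_num

/-- A graph with vertex set `U` and edge set `P` has at least `2 ^ |U| (3 / 4) ^ |P|` independent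
sets. -/
lemma card_independent_ge {α : Type*} [Fintype α] [DecidableEq α] (U : Finset α)
    (P : Finset (α × α)) (hP : ∀ e ∈ P, e.1 ≠ e.2) :
    (2 : ℝ) ^ U.card * (3 / 4) ^ P.card
      ≤ ((univ.filter fun x : Finset α => x ⊆ U ∧ ∀ e ∈ P, ¬ (e.1 ∈ x ∧ e.2 ∈ x)).card : ℝ) := by
  -- Degenerate pairs over the complement of U encode the condition `x ⊆ U`; their factors 1/2
  -- cancel the surplus in 2^|α|.
  set W := Uᶜ.image fun a => (a, a) with hW
  have hd : Disjoint P W := by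
    rw [disjoint_left]
    intro e he he'
    obtain ⟨a, _, rfl⟩ := mem_image.1 he'
    exact hP _ he rfl
  have h := card_avoiding_ge (P ∪ W)
  rw [prod_union hd, prod_congr rfl fun e he => if_neg (hP e he), prod_const,
    prod_image (fun a _ b _ h => (Prod.mk.inj h).1)] at h
  simp only [if_true, prod_const] at h
  refine le_trans (le_of_eq ?_) (h.trans (le_of_eq ?_))
  · rw [← card_add_card_compl U, pow_add]
    have : (2 : ℝ) ^ Uᶜ.card * (1 / 2) ^ Uᶜ.card = 1 := by
      rw [← mul_pow]; norm_num
    linear_combination (-(2 : ℝ) ^ U.card * (3 / 4) ^ P.card) * this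
  · congr 2
    ext x
    simp only [mem_filter, mem_univ, true_and, mem_union, or_imp, forall_and]
    rw [and_comm]
    refine and_congr_left fun _ => ?_
    constructor
    · intro h' a ha
      by_contra haU
      exact h' (a, a) (mem_image_of_mem _ (mem_compl.2 haU)) ⟨ha, ha⟩
    · intro h' e he hx
      obtain ⟨a, ha, rfl⟩ := mem_image.1 he
      exact mem_compl.1 ha (h' hx.1)

/-! ### Recolouring single vertices -/

variable {n k : ℕ}

/-- The vertex `v` has no neighbour in the communities in `C`. -/
def IsFree (σ : Labels n k) (G : SimpleGraph (Fin n)) (C : Finset (Fin k)) (v : Fin n) : Prop :=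
  σ v ∉ C ∧ ∀ w, G.Adj v w → σ w ∉ C

/-- The vertices outside the communities in `C` that have no neighbour in them. -/
noncomputable def freeSet (σ : Labels n k) (C : Finset (Fin k)) (G : SimpleGraph (Fin n)) :
    Finset (Fin n) :=
  univ.filter fun v => IsFree σ G C v

/-- The edges with two ends that can both be recoloured by `c`. -/
noncomputable def conflictSet (σ : Labels n k) (c : Fin k) (G : SimpleGraph (Fin n)) :
    Finset (Fin n × Fin n) :=
  (vertexPairs n).filter fun e => G.Adj e.1 e.2 ∧ IsFree σ G {c} e.1 ∧ IsFree σ G {c} e.2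

/-- The ordered pairs of colours. -/
def colorPairs (k : ℕ) : Finset (Fin k × Fin k) := univ.filter fun p => p.1 < p.2

/-- The recolouring of `σ` by a set of pairs of a vertex and a new colour. -/
noncomputable def recolor (σ : Labels n k) (x : Finset (Fin n × Fin k)) : Labels n k :=
  fun v => if h : ∃ c, (v, c) ∈ x then h.choose else σ v

lemma isFree_pair {σ : Labels n k} {G : SimpleGraph (Fin n)} {c d : Fin k} {v : Fin n}
    (hc : IsFree σ G {c} v) (hd : IsFree σ G {d} v) : IsFree σ G {c, d} v := by
  simp only [IsFree, mem_singleton, mem_insert, not_or] at *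
  exact ⟨⟨hc.1, hd.1⟩, fun w hw => ⟨hc.2 w hw, hd.2 w hw⟩⟩

/-- A proper colouring with many free vertices and few conflicts between them gives rise to many
proper colourings. -/
lemma card_proper_ge {σ : Labels n k} {G : SimpleGraph (Fin n)} (hσ : Proper G σ) :
    (2 : ℝ) ^ (∑ c, (freeSet σ {c} G).card) *
      (3 / 4) ^ (∑ p ∈ colorPairs k, (freeSet σ {p.1, p.2} G).card
        + ∑ c, (conflictSet σ c G).card)
      ≤ ((univ.filter fun τ : Labels n k => Proper G τ).card : ℝ) := by
  set U : Finset (Fin n × Fin k) := univ.filter fun a => IsFree σ G {a.2} a.1 with hU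
  set P₁ : Finset ((Fin n × Fin k) × (Fin n × Fin k)) :=
    ((colorPairs k).sigma fun p => freeSet σ {p.1, p.2} G).image
      fun y => ((y.2, y.1.1), (y.2, y.1.2)) with hP₁
  set P₂ : Finset ((Fin n × Fin k) × (Fin n × Fin k)) :=
    ((univ : Finset (Fin k)).sigma fun c => conflictSet σ c G).image
      fun y => ((y.2.1, y.1), (y.2.2, y.1)) with hP₂
  have hUc : U.card = ∑ c, (freeSet σ {c} G).card := by
    rw [card_eq_sum_card_fiberwise (f := Prod.snd) (t := univ) (fun _ _ => by simp)]
    refine sum_congr rfl fun c _ => ?_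
    refine card_bij' (fun a _ => a.1) (fun v _ => (v, c)) ?_ ?_ ?_ ?_
    · rintro ⟨v, d⟩ h
      simp only [hU, mem_filter, mem_univ, true_and, freeSet] at h ⊢
      exact h.2 ▸ h.1
    · intro v h
      simpa [hU, freeSet] using h
    · rintro ⟨v, d⟩ h
      simp only [mem_filter] at h
      rw [h.2]
    · simp
  have hPc : (P₁ ∪ P₂).card ≤ ∑ p ∈ colorPairs k, (freeSet σ {p.1, p.2} G).card
        + ∑ c, (conflictSet σ c G).card := by
    refine (card_union_le _ _).trans (add_le_add (card_image_le.trans ?_) (card_image_le.trans ?_))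
    · rw [card_sigma]
    · rw [card_sigma]
  have hne : ∀ e ∈ P₁ ∪ P₂, e.1 ≠ e.2 := by
    intro e he h
    rcases mem_union.1 he with he | he
    · obtain ⟨⟨p, v⟩, hy, rfl⟩ := mem_image.1 he
      have := (mem_sigma.1 hy).1
      simp only [colorPairs, mem_filter, mem_univ, true_and] at this
      simp only [Prod.mk.injEq, true_and] at h
      exact this.ne h
    · obtain ⟨⟨c, p⟩, hy, rfl⟩ := mem_image.1 he
      have := (mem_filter.1 (mem_sigma.1 hy).2).1
      simp only [Prod.mk.injEq, and_true] at h
      exact (mem_vertexPairs.1 this).ne h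
  refine le_trans ?_ ((card_independent_ge U (P₁ ∪ P₂) hne).trans ?_)
  · rw [hUc]
    exact mul_le_mul_of_nonneg_left (pow_le_pow_of_le_one (by norm_num) (by norm_num) hPc)
      (by positivity)
  · norm_cast
    -- Independence with respect to P₁ permits at most one new colour per vertex, so the choice
    -- inside `recolor` is forced.
    have hval : ∀ x : Finset (Fin n × Fin k), x ⊆ U → (∀ e ∈ P₁ ∪ P₂, ¬ (e.1 ∈ x ∧ e.2 ∈ x)) →
        ∀ v c, (v, c) ∈ x → recolor σ x v = c := by
      intro x hx hind v c hvc
      have hex : ∃ c, (v, c) ∈ x := ⟨c, hvc⟩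
      unfold recolor
      rw [dif_pos hex]
      have hd := hex.choose_spec
      set d := hex.choose with hdd
      by_contra hne'
      have key : ∀ c d : Fin k, c < d → (v, c) ∈ x → (v, d) ∈ x → False := by
        intro c d hcd h1 h2
        refine hind ((v, c), (v, d)) (mem_union_left _ (mem_image.2 ⟨⟨(c, d), v⟩, ?_, rfl⟩)) ⟨h1, h2⟩
        refine mem_sigma.2 ⟨by simpa [colorPairs] using hcd, ?_⟩
        simp only [freeSet, mem_filter, mem_univ, true_and]
        exact isFree_pair (by simpa [hU] using hx h1) (by simpa [hU] using hx h2)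
      rcases lt_or_gt_of_ne hne' with h | h
      · exact key _ _ h hd hvc
      · exact key _ _ h hvc hd
    have hval' : ∀ (x : Finset (Fin n × Fin k)) (v), (¬ ∃ c, (v, c) ∈ x) → recolor σ x v = σ v :=
      fun x v h => dif_neg h
    refine card_le_card_of_injOn (recolor σ) ?_ ?_
    · intro x hx
      simp only [coe_filter, mem_univ, true_and, Set.mem_ofPred_eq] at hx ⊢
      obtain ⟨hxU, hind⟩ := hx
      have hmem : ∀ v c, (v, c) ∈ x → IsFree σ G {c} v := fun v c h => by
        simpa [hU] using hxU h
      intro u v huv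
      by_cases hu : ∃ c, (u, c) ∈ x <;> by_cases hv : ∃ c, (v, c) ∈ x
      · obtain ⟨c, hc⟩ := hu
        obtain ⟨d, hd⟩ := hv
        rw [hval x hxU hind u c hc, hval x hxU hind v d hd]
        rintro rfl
        have key : ∀ u v : Fin n, u < v → G.Adj u v → (u, c) ∈ x → (v, c) ∈ x → False := by
          intro u v huv hadj h1 h2
          refine hind ((u, c), (v, c)) (mem_union_right _
            (mem_image.2 ⟨⟨c, (u, v)⟩, ?_, rfl⟩)) ⟨h1, h2⟩
          refine mem_sigma.2 ⟨mem_univ _, mem_filter.2 ⟨mem_vertexPairs.2 huv, hadj, ?_, ?_⟩⟩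
          · exact hmem u c h1
          · exact hmem v c h2
        rcases lt_or_gt_of_ne huv.ne with h | h
        · exact key _ _ h huv hc hd
        · exact key _ _ h huv.symm hd hc
      · obtain ⟨c, hc⟩ := hu
        rw [hval x hxU hind u c hc, hval' x v hv]
        have := (hmem u c hc).2 v huv
        rw [mem_singleton] at this
        exact fun h => this h.symm
      · obtain ⟨c, hc⟩ := hv
        rw [hval x hxU hind v c hc, hval' x u hu]
        have := (hmem v c hc).2 u huv.symm
        rwa [mem_singleton] at this
      · rw [hval' x u hu, hval' x v hv]
        exact hσ u v huv
    -- Injectivity: a free move always changes the colour of its vertex, so the set of moves can be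
    -- read off from the recolouring.
    · have key : ∀ x y : Finset (Fin n × Fin k), x ⊆ U → y ⊆ U →
          (∀ e ∈ P₁ ∪ P₂, ¬ (e.1 ∈ x ∧ e.2 ∈ x)) → (∀ e ∈ P₁ ∪ P₂, ¬ (e.1 ∈ y ∧ e.2 ∈ y)) →
          recolor σ x = recolor σ y → x ⊆ y := by
        rintro x y hx hy hix hiy hxy ⟨v, c⟩ hvc
        have h1 := hval x hx hix v c hvc
        have hfree : σ v ≠ c := by
          have := hx hvc
          simp only [hU, mem_filter, mem_univ, true_and, IsFree, mem_singleton] at this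
          exact this.1
        by_cases hv : ∃ d, (v, d) ∈ y
        · obtain ⟨d, hd⟩ := hv
          have h2 := hval y hy hiy v d hd
          rw [← hxy, h1] at h2
          rwa [h2]
        · have h2 := hval' y v hv
          rw [← hxy, h1] at h2
          exact absurd h2.symm hfree
      intro x hx y hy hxy
      simp only [coe_filter, mem_univ, true_and, Set.mem_ofPred_eq] at hx hy
      exact Subset.antisymm (key x y hx.1 hy.1 hx.2 hy.2 hxy) (key y x hy.1 hx.1 hy.2 hx.2 hxy.symm)

/-! ### Concentration of the numbers of free vertices and conflicts -/

section FreeVertices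

variable {n k : ℕ}

/-- The pairs consisting of `v` and a vertex of a community in `C`. -/
noncomputable def nbrPairs (σ : Labels n k) (C : Finset (Fin k)) (v : Fin n) :
    Finset (Fin n × Fin n) :=
  (vertexPairs n).filter fun e => (e.1 = v ∧ σ e.2 ∈ C) ∨ (e.2 = v ∧ σ e.1 ∈ C)

lemma nbrPairs_subset (σ : Labels n k) (C : Finset (Fin k)) (v : Fin n) :
    nbrPairs σ C v ⊆ vertexPairs n := filter_subset _ _

lemma mem_nbrPairs {σ : Labels n k} {C : Finset (Fin k)} {v : Fin n} {e : Fin n × Fin n} :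
    e ∈ nbrPairs σ C v ↔ e.1 < e.2 ∧ ((e.1 = v ∧ σ e.2 ∈ C) ∨ (e.2 = v ∧ σ e.1 ∈ C)) := by
  rw [nbrPairs, mem_filter, mem_vertexPairs]

lemma isFree_iff {σ : Labels n k} {C : Finset (Fin k)} {v : Fin n} (hv : σ v ∉ C)
    (G : SimpleGraph (Fin n)) : IsFree σ G C v ↔ ∀ e ∈ nbrPairs σ C v, ¬ G.Adj e.1 e.2 := by
  constructor
  · rintro ⟨_, h⟩ e he hadj
    rcases (mem_nbrPairs.1 he).2 with ⟨rfl, h2⟩ | ⟨rfl, h2⟩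
    · exact h _ hadj h2
    · exact h _ hadj.symm h2
  · refine fun h => ⟨hv, fun w hw hwC => ?_⟩
    rcases lt_or_gt_of_ne hw.ne with hlt | hlt
    · exact h (v, w) (mem_nbrPairs.2 ⟨hlt, Or.inl ⟨rfl, hwC⟩⟩) hw
    · exact h (w, v) (mem_nbrPairs.2 ⟨hlt, Or.inr ⟨rfl, hwC⟩⟩) hw.symm

lemma card_nbrPairs {σ : Labels n k} {C : Finset (Fin k)} {v : Fin n} (hv : σ v ∉ C) :
    (nbrPairs σ C v).card = (colorSet C σ).card := by
  have hne : ∀ w, w ∈ colorSet C σ → w ≠ v := by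
    rintro w hw rfl
    exact hv (by simpa [colorSet] using hw)
  symm
  refine card_bij' (fun w _ => if v < w then (v, w) else (w, v))
    (fun e _ => if e.1 = v then e.2 else e.1) ?_ ?_ ?_ ?_
  · intro w hw
    have hwC : σ w ∈ C := by simpa [colorSet] using hw
    rw [mem_nbrPairs]
    split_ifs with h
    · exact ⟨h, Or.inl ⟨rfl, hwC⟩⟩
    · exact ⟨lt_of_le_of_ne (not_lt.1 h) (hne w hw), Or.inr ⟨rfl, hwC⟩⟩
  · rintro ⟨x, y⟩ he
    rcases (mem_nbrPairs.1 he) with ⟨h, ⟨h1, h2⟩ | ⟨h1, h2⟩⟩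
    · obtain rfl : x = v := h1
      simpa [colorSet] using h2
    · have : x ≠ v := by
        rintro rfl
        exact hv h2
      simpa [colorSet, this] using h2
  · intro w hw
    split_ifs with h1 h2 h2
    · rfl
    · exact absurd rfl h2
    · exact absurd h2 (hne w hw)
    · rfl
  · rintro ⟨x, y⟩ he
    rcases (mem_nbrPairs.1 he) with ⟨h, ⟨h1, h2⟩ | ⟨h1, h2⟩⟩
    · simp only at h h1 h2
      subst h1
      simp [h]
    · simp only at h h1 h2
      subst h1
      simp [h.ne, h.not_gt]

/-- A common pair would have to join u and v, and then v would lie in a community of C. Hence the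
freeness events of distinct vertices outside C are independent. -/
lemma disjoint_nbrPairs {σ : Labels n k} {C : Finset (Fin k)} {u v : Fin n} (hv : σ v ∉ C)
    (huv : u ≠ v) : Disjoint (nbrPairs σ C u) (nbrPairs σ C v) := by
  rw [disjoint_left]
  intro e he he'
  rcases (mem_nbrPairs.1 he).2 with ⟨h1, h2⟩ | ⟨h1, h2⟩ <;>
    rcases (mem_nbrPairs.1 he').2 with ⟨h3, h4⟩ | ⟨h3, h4⟩
  · exact huv (h1.symm.trans h3)
  · exact hv (h3 ▸ h2)
  · exact hv (h3 ▸ h2)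
  · exact huv (h1.symm.trans h3)

lemma not_mem_nbrPairs {σ : Labels n k} {C : Finset (Fin k)} {e : Fin n × Fin n} (v : Fin n)
    (h1 : σ e.1 ∉ C) (h2 : σ e.2 ∉ C) : e ∉ nbrPairs σ C v := by
  intro he
  rcases (mem_nbrPairs.1 he).2 with ⟨_, h⟩ | ⟨_, h⟩
  · exact h2 h
  · exact h1 h

lemma card_freeSet (σ : Labels n k) (C : Finset (Fin k)) (G : SimpleGraph (Fin n)) :
    ((freeSet σ C G).card : ℝ) = ∑ v ∈ univ.filter (fun v => σ v ∉ C),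
      cylinder ∅ (nbrPairs σ C v) G := by
  rw [freeSet, card_filter, sum_filter]
  push_cast
  refine sum_congr rfl fun v _ => ?_
  by_cases hv : σ v ∉ C
  · rw [if_pos hv, cylinder]
    refine if_congr ?_ rfl rfl
    simp [isFree_iff hv]
  · rw [if_neg hv, if_neg fun h => hv h.1]

lemma card_conflictSet (σ : Labels n k) (c : Fin k) (G : SimpleGraph (Fin n)) :
    ((conflictSet σ c G).card : ℝ)
      = ∑ e ∈ (vertexPairs n).filter (fun e => σ e.1 ∉ ({c} : Finset (Fin k)) ∧
          σ e.2 ∉ ({c} : Finset (Fin k))),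
        cylinder {e} (nbrPairs σ {c} e.1 ∪ nbrPairs σ {c} e.2) G := by
  rw [conflictSet, card_filter, sum_filter]
  push_cast
  refine sum_congr rfl fun e _ => ?_
  by_cases he : σ e.1 ∉ ({c} : Finset (Fin k)) ∧ σ e.2 ∉ ({c} : Finset (Fin k))
  · rw [if_pos he, cylinder]
    refine if_congr ?_ rfl rfl
    rw [isFree_iff he.1, isFree_iff he.2]
    simp only [mem_singleton, forall_eq, mem_union, or_imp, forall_and]
  · rw [if_neg he, if_neg fun h => he ⟨h.2.1.1, h.2.2.1⟩]

variable {b : ℝ}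

lemma pairProb_nbrPairs (hn : b ≤ n) (hn0 : 0 < n) {σ : Labels n k} {C : Finset (Fin k)}
    {v : Fin n} (hv : σ v ∉ C) {e : Fin n × Fin n} (he : e ∈ nbrPairs σ C v) :
    pairProb (symmMatrix k 0 b) σ e = b / n := by
  rw [pairProb_symmMatrix hn hn0, if_neg]
  intro h
  rcases (mem_nbrPairs.1 he).2 with ⟨rfl, h2⟩ | ⟨rfl, h2⟩
  · exact hv (h ▸ h2)
  · exact hv (h ▸ h2)

lemma graphExp_free (hn : b ≤ n) (hn0 : 0 < n) {σ : Labels n k} {C : Finset (Fin k)}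
    {v : Fin n} (hv : σ v ∉ C) :
    graphExp (symmMatrix k 0 b) σ (cylinder ∅ (nbrPairs σ C v))
      = (1 - b / n) ^ (colorSet C σ).card := by
  rw [graphExp_cylinder σ (empty_subset _) (nbrPairs_subset _ _ _) (disjoint_empty_left _),
    prod_empty, one_mul, prod_congr rfl fun e he => by rw [pairProb_nbrPairs hn hn0 hv he],
    prod_const, card_nbrPairs hv]

lemma graphExp_conflict (hn : b ≤ n) (hn0 : 0 < n) {σ : Labels n k} {c : Fin k}
    {e : Fin n × Fin n} (he : e ∈ vertexPairs n) (h1 : σ e.1 ∉ ({c} : Finset (Fin k)))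
    (h2 : σ e.2 ∉ ({c} : Finset (Fin k))) :
    graphExp (symmMatrix k 0 b) σ (cylinder {e} (nbrPairs σ {c} e.1 ∪ nbrPairs σ {c} e.2))
      = (if σ e.1 = σ e.2 then 0 else b / n) * (1 - b / n) ^ (2 * (colorSet {c} σ).card) := by
  have hd := disjoint_nbrPairs h2 (mem_vertexPairs.1 he).ne
  rw [graphExp_cylinder σ (singleton_subset_iff.2 he)
    (union_subset (nbrPairs_subset _ _ _) (nbrPairs_subset _ _ _)), prod_singleton,
    pairProb_symmMatrix hn hn0, prod_union hd,
    prod_congr rfl fun e he => by rw [pairProb_nbrPairs hn hn0 h1 he],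
    prod_congr (s₁ := nbrPairs σ {c} e.2) rfl fun e he => by rw [pairProb_nbrPairs hn hn0 h2 he],
    prod_const, prod_const, card_nbrPairs h1, card_nbrPairs h2, ← pow_add, two_mul]
  rw [disjoint_singleton_left, mem_union, not_or]
  exact ⟨not_mem_nbrPairs _ h1 h2, not_mem_nbrPairs _ h1 h2⟩

lemma graphExp_le_one (hb : 0 ≤ b) (σ : Labels n k) {f : SimpleGraph (Fin n) → ℝ}
    (h : ∀ G, f G ≤ 1) : graphExp (symmMatrix k 0 b) σ f ≤ 1 := by
  refine (graphExp_mono (symmMatrix_zero_nonneg hb) σ h).trans (le_of_eq ?_)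
  simp [graphExp, sum_graphWeight]

lemma cylinder_le_one (H K : Finset (Fin n × Fin n)) (G : SimpleGraph (Fin n)) :
    cylinder H K G ≤ 1 := by
  unfold cylinder; split_ifs <;> norm_num

/-- The mean number of vertices outside `C` without a neighbour in `C`. -/
noncomputable def meanFree (b : ℝ) (σ : Labels n k) (C : Finset (Fin k)) : ℝ :=
  (n - (colorSet C σ).card) * (1 - b / n) ^ (colorSet C σ).card

lemma graphExp_freeSet_deviation_le (hb : 0 ≤ b) (hn : b ≤ n) (hn0 : 0 < n) (σ : Labels n k)
    (C : Finset (Fin k)) {t : ℝ} (ht : 0 < t) :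
    graphExp (symmMatrix k 0 b) σ (fun G =>
      if t * n ≤ |((freeSet σ C G).card : ℝ) - meanFree b σ C| then 1 else 0)
      ≤ 1 / t ^ 2 / n := by
  have hn' : (0 : ℝ) < n := by exact_mod_cast hn0
  have hQ := symmMatrix_zero_nonneg (k := k) hb
  set I := univ.filter (fun v => σ v ∉ C) with hI
  have hmem : ∀ v ∈ I, σ v ∉ C := fun v hv => (mem_filter.1 hv).2
  have hV : ∑ u ∈ I, ∑ v ∈ I, (graphExp (symmMatrix k 0 b) σ (fun G =>
      cylinder ∅ (nbrPairs σ C u) G * cylinder ∅ (nbrPairs σ C v) G)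
      - graphExp (symmMatrix k 0 b) σ (cylinder ∅ (nbrPairs σ C u))
        * graphExp (symmMatrix k 0 b) σ (cylinder ∅ (nbrPairs σ C v))) ≤ (n : ℝ) := by
    calc _ ≤ ∑ u ∈ I, ∑ v ∈ I, (if u = v then (1 : ℝ) else 0) := by
          refine sum_le_sum fun u hu => sum_le_sum fun v hv => ?_
          split_ifs with h
          · have h1 := graphExp_le_one (k := k) hb σ (f := fun G =>
              cylinder ∅ (nbrPairs σ C u) G * cylinder ∅ (nbrPairs σ C v) G) (fun G =>
              mul_le_one₀ (cylinder_le_one _ _ G) (cylinder_nonneg _ _ G) (cylinder_le_one _ _ G))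
            have h2 := mul_nonneg (graphExp_nonneg hQ σ (cylinder_nonneg ∅ (nbrPairs σ C u)))
              (graphExp_nonneg hQ σ (cylinder_nonneg ∅ (nbrPairs σ C v)))
            linarith
          · rw [graphExp_cylinder_mul σ (empty_subset _) (nbrPairs_subset _ _ _)
              (disjoint_empty_left _) (empty_subset _) (nbrPairs_subset _ _ _)
              (disjoint_empty_left _), sub_self]
            rw [empty_union, empty_union]
            exact disjoint_nbrPairs (hmem v hv) h
      _ = I.card := by
          rw [sum_congr rfl fun u hu => by rw [sum_ite_eq, if_pos hu]]
          simp
      _ ≤ n := by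
          have := card_le_univ I
          rw [Fintype.card_fin] at this
          exact_mod_cast this
  have h := graphExp_chebyshev hQ σ I (fun v => cylinder ∅ (nbrPairs σ C v)) (a := t * n)
    (by positivity) hV
  have hm : ∑ v ∈ I, graphExp (symmMatrix k 0 b) σ (cylinder ∅ (nbrPairs σ C v))
      = meanFree b σ C := by
    rw [sum_congr rfl fun v hv => graphExp_free hn hn0 (hmem v hv), sum_const, nsmul_eq_mul,
      meanFree]
    congr 1
    rw [eq_sub_iff_add_eq, add_comm]
    have := card_filter_add_card_filter_not (s := (univ : Finset (Fin n))) (fun v => σ v ∈ C)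
    rw [card_univ, Fintype.card_fin] at this
    exact_mod_cast this
  rw [hm] at h
  simp_rw [hI, ← card_freeSet] at h
  refine h.trans (le_of_eq ?_)
  field_simp

/-- The mean number of edges with two ends that can both be recoloured by `c`. -/
noncomputable def meanConflict (b : ℝ) (σ : Labels n k) (c : Fin k) : ℝ :=
  (∑ e ∈ (vertexPairs n).filter (fun e => σ e.1 ∉ ({c} : Finset (Fin k)) ∧
      σ e.2 ∉ ({c} : Finset (Fin k))), if σ e.1 = σ e.2 then 0 else b / n)
    * (1 - b / n) ^ (2 * (colorSet {c} σ).card)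

lemma graphExp_cylinder_le (hb : 0 ≤ b) (hn : b ≤ n) (hn0 : 0 < n) (σ : Labels n k)
    {H : Finset (Fin n × Fin n)} (hH : H ⊆ vertexPairs n) :
    graphExp (symmMatrix k 0 b) σ (cylinder H ∅) ≤ (b / n) ^ H.card := by
  rw [graphExp_cylinder σ hH (empty_subset _) (disjoint_empty_right _), prod_empty, mul_one,
    ← prod_const]
  refine prod_le_prod (fun e _ => pairProb_nonneg (symmMatrix_zero_nonneg hb) σ e) fun e _ => ?_
  rw [pairProb_symmMatrix hn hn0]
  split_ifs
  · positivity
  · exact le_rfl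

/-- Chebyshev again. Conflicts without a common vertex depend on disjoint sets of pairs and are
independent. Distinct conflicts with a common vertex have covariance at most (b/n)², and an edge
with itself at most b/n; together this gives variance at most (b + 4b²)n. -/
lemma graphExp_conflictSet_deviation_le (hb : 0 ≤ b) (hn : b ≤ n) (hn0 : 0 < n)
    (σ : Labels n k) (c : Fin k) {t : ℝ} (ht : 0 < t) :
    graphExp (symmMatrix k 0 b) σ (fun G =>
      if t * n ≤ |((conflictSet σ c G).card : ℝ) - meanConflict b σ c| then 1 else 0)
      ≤ (b + 4 * b ^ 2) / t ^ 2 / n := by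
  have hn' : (0 : ℝ) < n := by exact_mod_cast hn0
  have hQ := symmMatrix_zero_nonneg (k := k) hb
  set I := (vertexPairs n).filter (fun e => σ e.1 ∉ ({c} : Finset (Fin k)) ∧
      σ e.2 ∉ ({c} : Finset (Fin k))) with hI
  have hmem : ∀ e ∈ I, e ∈ vertexPairs n ∧ σ e.1 ∉ ({c} : Finset (Fin k)) ∧
      σ e.2 ∉ ({c} : Finset (Fin k)) := fun e he => mem_filter.1 he
  set K : Fin n × Fin n → Finset (Fin n × Fin n) := fun e =>
    nbrPairs σ {c} e.1 ∪ nbrPairs σ {c} e.2 with hK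
  have hKs : ∀ e, K e ⊆ vertexPairs n := fun e =>
    union_subset (nbrPairs_subset _ _ _) (nbrPairs_subset _ _ _)
  have hKd : ∀ e ∈ I, ∀ f, Disjoint {e} (K f) := by
    intro e he f
    rw [disjoint_singleton_left, hK, mem_union, not_or]
    exact ⟨not_mem_nbrPairs _ (hmem e he).2.1 (hmem e he).2.2,
      not_mem_nbrPairs _ (hmem e he).2.1 (hmem e he).2.2⟩
  have hV : ∑ e ∈ I, ∑ f ∈ I, (graphExp (symmMatrix k 0 b) σ (fun G =>
      cylinder {e} (K e) G * cylinder {f} (K f) G)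
      - graphExp (symmMatrix k 0 b) σ (cylinder {e} (K e))
        * graphExp (symmMatrix k 0 b) σ (cylinder {f} (K f))) ≤ (b + 4 * b ^ 2) * n := by
    -- Each of the four indicators of a common end sums to n³ over all ordered pairs of pairs, and
    -- the diagonal sums to n² · b/n.
    set B : Fin n × Fin n → Fin n × Fin n → ℝ := fun e f => (if e = f then b / n else 0)
      + (b / n) ^ 2 * ((if e.1 = f.1 then 1 else 0) + (if e.1 = f.2 then 1 else 0)
        + (if e.2 = f.1 then 1 else 0) + (if e.2 = f.2 then 1 else 0)) with hB
    have hB0 : ∀ e f, 0 ≤ B e f := by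
      intro e f
      simp only [hB]
      positivity
    calc _ ≤ ∑ e ∈ I, ∑ f ∈ I, B e f := by
          refine sum_le_sum fun e he => sum_le_sum fun f hf => ?_
          have hee := (hmem e he).1
          have hff := (hmem f hf).1
          have h2 := mul_nonneg (graphExp_nonneg hQ σ (cylinder_nonneg {e} (K e)))
            (graphExp_nonneg hQ σ (cylinder_nonneg {f} (K f)))
          have hle : graphExp (symmMatrix k 0 b) σ (fun G =>
              cylinder {e} (K e) G * cylinder {f} (K f) G) ≤ (b / n) ^ ({e} ∪ {f} :
                Finset (Fin n × Fin n)).card := by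
            simp_rw [cylinder_mul]
            refine (graphExp_mono hQ σ (cylinder_anti Subset.rfl (empty_subset _))).trans
              (graphExp_cylinder_le hb hn hn0 σ (union_subset (singleton_subset_iff.2 hee)
                (singleton_subset_iff.2 hff)))
          by_cases hef : e = f
          · subst hef
            rw [union_self, card_singleton, pow_one] at hle
            have : b / n ≤ B e e := by
              simp only [hB, if_true]
              have : 0 ≤ (b / n) ^ 2 * ((1 : ℝ) + (if e.1 = e.2 then 1 else 0)
                + (if e.2 = e.1 then 1 else 0) + 1) := by positivity
              linarith
            linarith
          · have hcard : ({e} ∪ {f} : Finset (Fin n × Fin n)).card = 2 := by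
              rw [card_union_of_disjoint (by simpa using hef)]
              simp
            rw [hcard] at hle
            by_cases hs : e.1 = f.1 ∨ e.1 = f.2 ∨ e.2 = f.1 ∨ e.2 = f.2
            · have h1 : (1 : ℝ) ≤ (if e.1 = f.1 then 1 else 0) + (if e.1 = f.2 then 1 else 0)
                  + (if e.2 = f.1 then 1 else 0) + (if e.2 = f.2 then 1 else 0) := by
                rcases hs with h | h | h | h <;> rw [if_pos h] <;> split_ifs <;> norm_num
              have h3 : (b / n) ^ 2 ≤ B e f := by
                simp only [hB, if_neg hef, zero_add]
                exact le_mul_of_one_le_right (by positivity) h1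
              linarith
            · push Not at hs
              rw [graphExp_cylinder_mul σ (singleton_subset_iff.2 hee) (hKs e) (hKd e he e)
                (singleton_subset_iff.2 hff) (hKs f) (hKd f hf f), sub_self]
              · exact hB0 e f
              · simp only [disjoint_union_left, disjoint_union_right]
                refine ⟨⟨by simpa using hef, (hKd f hf e).symm⟩, hKd e he f, ?_⟩
                simp only [hK, disjoint_union_left, disjoint_union_right]
                obtain ⟨-, f1, f2⟩ := hmem f hf
                exact ⟨⟨disjoint_nbrPairs f1 hs.1, disjoint_nbrPairs f1 hs.2.2.1⟩,
                  disjoint_nbrPairs f2 hs.2.1, disjoint_nbrPairs f2 hs.2.2.2⟩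
      _ ≤ ∑ e, ∑ f, B e f := by
          refine (sum_le_sum fun e _ => sum_le_univ_sum_of_nonneg (hB0 e)).trans
            (sum_le_univ_sum_of_nonneg fun e => sum_nonneg fun f _ => hB0 e f)
      _ = (b + 4 * b ^ 2) * n := by
          have s0 : ∑ e : Fin n × Fin n, ∑ f : Fin n × Fin n, (if e = f then b / n else 0)
              = n * n * (b / n) := by simp
          have q1 : ∀ x : Fin n, ∑ f : Fin n × Fin n, (if x = f.1 then (1 : ℝ) else 0) = n := by
            intro x
            rw [Fintype.sum_prod_type_right]
            simp only [sum_ite_eq, mem_univ, if_true, sum_const, card_univ, Fintype.card_fin,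
              nsmul_eq_mul, mul_one]
          have q2 : ∀ x : Fin n, ∑ f : Fin n × Fin n, (if x = f.2 then (1 : ℝ) else 0) = n := by
            intro x
            rw [Fintype.sum_prod_type]
            simp only [sum_ite_eq, mem_univ, if_true, sum_const, card_univ, Fintype.card_fin,
              nsmul_eq_mul, mul_one]
          simp only [hB, sum_add_distrib, ← mul_sum]
          simp only [s0, q1, q2, sum_const, card_univ, Fintype.card_prod, Fintype.card_fin,
            nsmul_eq_mul]
          push_cast
          field_simp
          ring
  have h := graphExp_chebyshev hQ σ I (fun e => cylinder {e} (K e)) (a := t * n)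
    (by positivity) hV
  have hm : ∑ e ∈ I, graphExp (symmMatrix k 0 b) σ (cylinder {e} (K e))
      = meanConflict b σ c := by
    rw [meanConflict, sum_mul]
    exact sum_congr rfl fun e he => graphExp_conflict hn hn0 (hmem e he).1 (hmem e he).2.1
      (hmem e he).2.2
  rw [hm] at h
  simp_rw [hI, hK, ← card_conflictSet] at h
  refine h.trans (le_of_eq ?_)
  field_simp

end FreeVertices

/-! ### Estimates of the means for balanced labellings -/

section Balanced

variable {n k : ℕ}

lemma card_filter_label_not_mem (σ : Labels n k) (C : Finset (Fin k)) :
    ((univ.filter fun v => σ v ∉ C).card : ℝ) = n - (colorSet C σ).card := by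
  rw [eq_sub_iff_add_eq, add_comm]
  have := card_filter_add_card_filter_not (s := (univ : Finset (Fin n))) (fun v => σ v ∈ C)
  rw [card_univ, Fintype.card_fin] at this
  exact_mod_cast this

lemma card_colorSet_eq_sum (σ : Labels n k) (C : Finset (Fin k)) :
    ((colorSet C σ).card : ℝ) = ∑ c ∈ C, ((community σ c).card : ℝ) := by
  rw [card_eq_sum_card_fiberwise (f := σ) (t := C) (fun v hv => by simpa [colorSet] using hv)]
  push_cast
  refine sum_congr rfl fun c hc => ?_
  congr 2
  ext v
  simp only [colorSet, community, mem_filter, mem_univ, true_and, and_iff_right_iff_imp]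
  rintro rfl
  exact hc

lemma Balanced.abs_colorSet_le {t : ℝ} {σ : Labels n k} (hσ : Balanced t σ) (C : Finset (Fin k)) :
    |((colorSet C σ).card : ℝ) / n - C.card / k| ≤ C.card * t := by
  have : ((colorSet C σ).card : ℝ) / n - C.card / k
      = ∑ c ∈ C, (((community σ c).card : ℝ) / n - 1 / k) := by
    rw [card_colorSet_eq_sum, sum_sub_distrib, ← sum_div, sum_const, nsmul_eq_mul]
    ring
  rw [this]
  refine (abs_sum_le_sum_abs _ _).trans ((sum_le_sum fun c _ => hσ c).trans ?_)
  rw [sum_const, nsmul_eq_mul]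

lemma Balanced.colorSet_bounds {t : ℝ} {σ : Labels n k} (hσ : Balanced t σ) (hn : 0 < n)
    (C : Finset (Fin k)) :
    n * (C.card / k - C.card * t) ≤ (colorSet C σ).card ∧
      ((colorSet C σ).card : ℝ) ≤ n * (C.card / k + C.card * t) := by
  have hn' : (0 : ℝ) < n := by exact_mod_cast hn
  have h := abs_le.1 (hσ.abs_colorSet_le C)
  have e : ((colorSet C σ).card : ℝ) = n * (((colorSet C σ).card : ℝ) / n) := by field_simp
  constructor
  · rw [e]
    exact mul_le_mul_of_nonneg_left (by linarith [h.1]) hn'.le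
  · rw [e]
    exact mul_le_mul_of_nonneg_left (by linarith [h.2]) hn'.le

/-- From log(1-x) ≥ -x/(1-x) ≥ -x/(1-y); the fixed y keeps the correction to the exponent
independent of n. -/
lemma exp_le_one_sub_pow {x y : ℝ} (hx : 0 ≤ x) (hxy : x ≤ y) (hy : y < 1) (m : ℕ) :
    Real.exp (-(x * m / (1 - y))) ≤ (1 - x) ^ m := by
  have h1 : 0 < 1 - x := by linarith
  rw [← Real.exp_log (pow_pos h1 m), Real.log_pow]
  refine Real.exp_le_exp.2 ?_
  have h2 := Real.one_sub_inv_le_log_of_pos h1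
  have h3 : -(x / (1 - y)) ≤ 1 - (1 - x)⁻¹ := by
    have : 1 - (1 - x)⁻¹ = -(x / (1 - x)) := by field_simp; ring
    rw [this]
    exact neg_le_neg (div_le_div_of_nonneg_left hx (by linarith) (by linarith))
  calc -(x * m / (1 - y)) = m * (-(x / (1 - y))) := by ring
    _ ≤ m * Real.log (1 - x) := mul_le_mul_of_nonneg_left (h3.trans h2) m.cast_nonneg

lemma one_sub_pow_le_exp {x : ℝ} (hx : x ≤ 1) (m : ℕ) : (1 - x) ^ m ≤ Real.exp (-(x * m)) := by
  calc (1 - x) ^ m ≤ Real.exp (-x) ^ m :=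
        pow_le_pow_left₀ (by linarith) (Real.one_sub_le_exp_neg x) m
    _ = Real.exp (-(x * m)) := by rw [← Real.exp_nat_mul]; ring_nf

variable {b t : ℝ}

lemma meanFree_ge {σ : Labels n 4} (hσ : Balanced t σ) (hb : 0 ≤ b) (hn : 0 < n) (hbn : b / n ≤ t)
    (ht : t ≤ 1 / 2) (c : Fin 4) :
    n * ((3 / 4 - t) * Real.exp (-(b * (1 / 4 + t) / (1 - t)))) ≤ meanFree b σ {c} := by
  have hn' : (0 : ℝ) < n := by exact_mod_cast hn
  have hx : 0 ≤ b / n := by positivity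
  have h := (hσ.colorSet_bounds hn {c}).2
  rw [card_singleton] at h
  push_cast at h
  rw [meanFree, ← mul_assoc]
  refine mul_le_mul (by linarith) (le_trans ?_ (exp_le_one_sub_pow hx hbn (by linarith) _))
    (Real.exp_pos _).le (by nlinarith)
  refine Real.exp_le_exp.2 (neg_le_neg (div_le_div_of_nonneg_right ?_ (by linarith)))
  calc b / n * ((colorSet {c} σ).card : ℝ) ≤ b / n * (n * (1 / 4 + 1 * t)) :=
        mul_le_mul_of_nonneg_left h hx
    _ = b * (1 / 4 + t) := by field_simp

lemma meanFree_le {σ : Labels n 4} (hσ : Balanced t σ) (hb : 0 ≤ b) (hn : 0 < n) (hbn : b ≤ n)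
    {c d : Fin 4} (hcd : c ≠ d) :
    meanFree b σ {c, d} ≤ n * ((1 / 2 + 2 * t) * Real.exp (-(b * (1 / 2 - 2 * t)))) := by
  have hn' : (0 : ℝ) < n := by exact_mod_cast hn
  have hx : 0 ≤ b / n := by positivity
  have hx1 : b / n ≤ 1 := (div_le_one hn').2 hbn
  have h := (hσ.colorSet_bounds hn {c, d}).1
  rw [card_pair hcd] at h
  push_cast at h
  have hp : (1 - b / n) ^ (colorSet {c, d} σ).card ≤ Real.exp (-(b * (1 / 2 - 2 * t))) := by
    refine (one_sub_pow_le_exp hx1 _).trans (Real.exp_le_exp.2 (neg_le_neg ?_))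
    calc b * (1 / 2 - 2 * t) = b / n * (n * (2 / 4 - 2 * t)) := by field_simp; ring
      _ ≤ _ := mul_le_mul_of_nonneg_left h hx
  rw [meanFree, ← card_filter_label_not_mem, ← mul_assoc]
  refine mul_le_mul ?_ hp (pow_nonneg (by linarith) _) ?_
  · rw [card_filter_label_not_mem]
    linarith
  · have : (0 : ℝ) ≤ (univ.filter fun v => σ v ∉ ({c, d} : Finset (Fin 4))).card := by positivity
    rw [card_filter_label_not_mem] at this
    linarith

lemma meanConflict_le {σ : Labels n 4} (hσ : Balanced t σ) (ht : 0 ≤ t) (hb : 0 ≤ b) (hn : 0 < n)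
    (hbn : b ≤ n) (c : Fin 4) :
    meanConflict b σ c ≤ n * (b / 2 * (3 / 4 + t) * (1 / 2 + 2 * t)
      * Real.exp (-(b * (1 / 2 - 2 * t)))) := by
  have hn' : (0 : ℝ) < n := by exact_mod_cast hn
  have hx : 0 ≤ b / n := by positivity
  have hx1 : b / n ≤ 1 := (div_le_one hn').2 hbn
  have hc := (hσ.colorSet_bounds hn {c}).1
  rw [card_singleton] at hc
  push_cast at hc
  have hp : (1 - b / n) ^ (2 * (colorSet {c} σ).card) ≤ Real.exp (-(b * (1 / 2 - 2 * t))) := by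
    refine (one_sub_pow_le_exp hx1 _).trans (Real.exp_le_exp.2 (neg_le_neg ?_))
    push_cast
    calc b * (1 / 2 - 2 * t) = b / n * (2 * (n * (1 / 4 - 1 * t))) := by field_simp; ring
      _ ≤ _ := mul_le_mul_of_nonneg_left (by linarith) hx
  have hsum : (∑ e ∈ (vertexPairs n).filter (fun e => σ e.1 ∉ ({c} : Finset (Fin 4)) ∧
      σ e.2 ∉ ({c} : Finset (Fin 4))), if σ e.1 = σ e.2 then 0 else b / n)
      ≤ n * (b / 2 * (3 / 4 + t) * (1 / 2 + 2 * t)) := by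
    rw [sum_filter, sum_vertexPairs]
    rotate_left
    · intro u v
      simp only [eq_comm, and_comm]
    · intro u
      simp
    have hu : ∀ u, (∑ v, if σ u ∉ ({c} : Finset (Fin 4)) ∧ σ v ∉ ({c} : Finset (Fin 4)) then
        (if σ u = σ v then 0 else b / n) else 0)
        ≤ (if σ u ∉ ({c} : Finset (Fin 4)) then 1 else 0) * (b * (1 / 2 + 2 * t)) := by
      intro u
      by_cases h : σ u ∉ ({c} : Finset (Fin 4))
      · rw [if_pos h, one_mul]
        have hne : c ≠ σ u := fun h' => h (by simp [h'])
        have h2 := (hσ.colorSet_bounds hn {c, σ u}).1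
        rw [card_pair hne] at h2
        push_cast at h2
        -- A neighbour v of u in a conflict avoids both the new colour c and the colour of u, which
        -- leaves about half of the vertices.
        calc _ ≤ ∑ v, (if σ v ∉ ({c, σ u} : Finset (Fin 4)) then b / n else 0) := by
              refine sum_le_sum fun v _ => ?_
              by_cases h3 : σ u = σ v
              · simp only [h3, if_true, ite_self]
                split_ifs <;> positivity
              · by_cases h4 : σ v ∈ ({c} : Finset (Fin 4))
                · rw [if_neg (by tauto)]
                  split_ifs <;> positivity
                · rw [if_pos ⟨h, h4⟩, if_neg h3, if_pos]
                  rw [mem_insert, mem_singleton, not_or]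
                  exact ⟨fun h5 => h4 (by simp [h5]), fun h5 => h3 h5.symm⟩
          _ = (n - (colorSet {c, σ u} σ).card) * (b / n) := by
              rw [← sum_filter, sum_const, nsmul_eq_mul, card_filter_label_not_mem]
          _ ≤ (n * (1 / 2 + 2 * t)) * (b / n) := mul_le_mul_of_nonneg_right (by linarith) hx
          _ = b * (1 / 2 + 2 * t) := by field_simp
      · rw [if_neg h, zero_mul]
        exact (sum_eq_zero fun v _ => if_neg fun h' => h h'.1).le
    have h5 := sum_le_sum fun u (_ : u ∈ univ) => hu u
    rw [← sum_mul, ← sum_filter, sum_const, nsmul_eq_mul, mul_one, card_filter_label_not_mem] at h5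
    have h6 : (n - ((colorSet {c} σ).card : ℝ)) * (b * (1 / 2 + 2 * t))
        ≤ (n * (3 / 4 + t)) * (b * (1 / 2 + 2 * t)) :=
      mul_le_mul_of_nonneg_right (by linarith) (by positivity)
    linarith
  rw [meanConflict]
  refine (mul_le_mul hsum hp (pow_nonneg (by linarith) _) (by positivity)).trans (le_of_eq ?_)
  ring

end Balanced

/-! ### Four communities: the number of colourings -/

/-- A lower bound for the exponential growth rate of the number of recolourings of the planted
colouring with four colours. -/
noncomputable def recolorRate (t : ℝ) : ℝ :=
  4 * ((3 / 4 - t) * Real.exp (-(bParam 4 t * (1 / 4 + t) / (1 - t))) - t) * Real.log 2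
  - (6 * ((1 / 2 + 2 * t) * Real.exp (-(bParam 4 t * (1 / 2 - 2 * t))) + t)
    + 4 * (bParam 4 t / 2 * (3 / 4 + t) * (1 / 2 + 2 * t)
      * Real.exp (-(bParam 4 t * (1 / 2 - 2 * t))) + t)) * Real.log (4 / 3)

lemma recolorRate_zero : 0.094 < recolorRate 0 := by
  have h : Real.log (4 / 3) = 2 * Real.log 2 - Real.log 3 := by
    rw [Real.log_div (by norm_num) (by norm_num), show (4 : ℝ) = 2 ^ 2 by norm_num, Real.log_pow]
    norm_num
  have hb : bParam 4 0 = 12 := by unfold bParam; norm_num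
  obtain ⟨x, hx⟩ : ∃ x, x = Real.exp (-3) := ⟨_, rfl⟩
  have h6 : Real.exp (-6) = x ^ 2 := by
    rw [hx, ← Real.exp_nat_mul]
    norm_num
  have hx1 : x = (Real.exp 1 ^ 3)⁻¹ := by
    rw [hx, Real.exp_neg, ← Real.exp_nat_mul]
    norm_num
  have e1 := Real.exp_one_gt_d9
  have e2 := Real.exp_one_lt_d9
  have lo : 0.0497 < x := by
    rw [hx1, lt_inv_comm₀ (by norm_num) (by positivity)]
    calc Real.exp 1 ^ 3 < 2.7182818286 ^ 3 := pow_lt_pow_left₀ e2 (by positivity) (by norm_num)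
      _ < _ := by norm_num
  have hi : x < 0.0498 := by
    rw [hx1, inv_lt_comm₀ (by positivity) (by norm_num)]
    calc _ < (2.7182818283 : ℝ) ^ 3 := by norm_num
      _ < Real.exp 1 ^ 3 := pow_lt_pow_left₀ e1 (by norm_num) (by norm_num)
  -- At b = 12 and per vertex of G, there are 4 · (3/4)e⁻³ free moves, 6 · (1/2)e⁻⁶ clashes of two
  -- colours at one vertex and 4 · (9/4)e⁻⁶ clashes along edges.
  have hr : recolorRate 0 = 3 * x * Real.log 2 - 12 * x ^ 2 * Real.log (4 / 3) := by
    unfold recolorRate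
    rw [hb]
    norm_num
    rw [h6, ← hx]
    ring
  rw [hr, h]
  have l1 := Real.log_two_gt_d9
  have l2 := Real.log_two_lt_d9
  have l3 := Real.log_three_gt_d9
  have a1 : 3 * 0.0497 * 0.6931471803 ≤ 3 * x * Real.log 2 :=
    mul_le_mul (by linarith) l1.le (by norm_num) (by linarith)
  have a2 : 12 * x ^ 2 * (2 * Real.log 2 - Real.log 3) ≤ 12 * 0.0498 ^ 2 * 0.2876820732 :=
    mul_le_mul (by nlinarith) (by linarith) (by linarith [Real.log_three_lt_d9]) (by norm_num)
  norm_num at a1 a2 ⊢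
  linarith

lemma eventually_recolorRate : ∀ᶠ t in 𝓝 (0 : ℝ), 0.094 < recolorRate t := by
  have : ContinuousAt recolorRate 0 := by
    unfold recolorRate bParam
    have : (1 : ℝ) - 0 ≠ 0 := by norm_num
    fun_prop (disch := assumption)
  exact this.eventually_const_lt recolorRate_zero

/-- Both fractions lie in [0, 1], so a tolerance of at least 1 removes the size condition. For four
communities this admits recolourings whatever they do to the size of the colour set. -/
lemma card_colorings_of_one_le {n k : ℕ} {C : Finset (Fin k)} {q : ℝ}
    (hq : 1 ≤ q) (G : SimpleGraph (Fin n)) :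
    colorings C q G = univ.filter fun τ : Labels n k => Proper G τ := by
  unfold colorings
  refine filter_congr fun τ _ => and_iff_left ?_
  have h1 : ((colorSet C τ).card : ℝ) / n ≤ 1 := by
    refine div_le_one_of_le₀ ?_ (by positivity)
    have := card_le_univ (colorSet C τ)
    rw [Fintype.card_fin] at this
    exact_mod_cast this
  have h2 : (C.card : ℝ) / k ≤ 1 := by
    refine div_le_one_of_le₀ ?_ (by positivity)
    have := card_le_univ C
    rw [Fintype.card_fin] at this
    exact_mod_cast this
  have h3 : 0 ≤ ((colorSet C τ).card : ℝ) / n := by positivity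
  have h4 : 0 ≤ (C.card : ℝ) / k := by positivity
  rw [abs_le]
  constructor <;> linarith

/-- The planted colouring is proper almost surely. -/
lemma sbmProb_not_proper {n k : ℕ} (p : Fin k → ℝ) (b : ℝ) :
    sbmProb n p (symmMatrix k 0 b) (fun σ G => ¬ Proper G σ) = 0 := by
  refine sum_eq_zero fun σ _ => sum_eq_zero fun G _ => ?_
  by_cases h : Proper G σ
  · rw [if_neg (not_not.2 h)]
  · rw [if_pos h, sbmWeight]
    refine mul_eq_zero_of_right _ ?_
    simp only [Proper, not_forall, not_not] at h
    obtain ⟨u, v, huv, hσ⟩ := h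
    have key : ∀ u v, u < v → G.Adj u v → σ u = σ v → graphWeight (symmMatrix k 0 b) σ G = 0 := by
      intro u v hlt hadj hσ
      refine prod_eq_zero (mem_vertexPairs.2 (show (u, v).1 < (u, v).2 from hlt)) ?_
      rw [if_pos hadj]
      simp [edgeProb, symmMatrix, hσ]
    rcases lt_or_gt_of_ne huv.ne with hlt | hlt
    · exact key u v hlt huv hσ
    · exact key v u hlt huv.symm hσ.symm

lemma exp_le_card_proper {n : ℕ} {t : ℝ} (ht0 : 0 < t) (ht : t ≤ 1 / 8) (hn : 0 < n)
    (hbn : bParam 4 t / n ≤ t) {σ : Labels n 4} {G : SimpleGraph (Fin n)} (hσ : Balanced t σ)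
    (hG : Proper G σ)
    (hF : ∀ c, |((freeSet σ {c} G).card : ℝ) - meanFree (bParam 4 t) σ {c}| < t * n)
    (hD : ∀ c d, |((freeSet σ {c, d} G).card : ℝ) - meanFree (bParam 4 t) σ {c, d}| < t * n)
    (hE : ∀ c, |((conflictSet σ c G).card : ℝ) - meanConflict (bParam 4 t) σ c| < t * n) :
    Real.exp (recolorRate t * n) ≤ ((univ.filter fun τ : Labels n 4 => Proper G τ).card : ℝ) := by
  have hn' : (0 : ℝ) < n := by exact_mod_cast hn
  have hb0 : 0 ≤ bParam 4 t := bParam_nonneg (by norm_num) (by linarith)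
  have hbn' : bParam 4 t ≤ n := by
    rw [div_le_iff₀ hn'] at hbn
    nlinarith
  refine le_trans ?_ (card_proper_ge hG)
  set A := ∑ c, (freeSet σ {c} G).card with hA
  set B := ∑ p ∈ colorPairs 4, (freeSet σ {p.1, p.2} G).card + ∑ c, (conflictSet σ c G).card with hB
  have e1 : (2 : ℝ) ^ A * (3 / 4) ^ B = Real.exp (A * Real.log 2 - B * Real.log (4 / 3)) := by
    have h1 := pow_eq_exp_mul_log (N := A) (x := 2) (by norm_num) (by norm_num)
    have h2 := pow_eq_exp_mul_log (N := B) (x := 3 / 4) (by norm_num) (by norm_num)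
    have h3 : Real.log (3 / 4) = -Real.log (4 / 3) := by
      rw [← Real.log_inv]
      norm_num
    rw [h1, h2, h3, ← Real.exp_add]
    congr 1
    ring
  rw [e1]
  refine Real.exp_le_exp.2 ?_
  have hA' : n * (4 * ((3 / 4 - t) * Real.exp (-(bParam 4 t * (1 / 4 + t) / (1 - t))) - t))
      ≤ (A : ℝ) := by
    have h1 : ∀ c, n * ((3 / 4 - t) * Real.exp (-(bParam 4 t * (1 / 4 + t) / (1 - t))) - t)
        ≤ ((freeSet σ {c} G).card : ℝ) := by
      intro c
      have := meanFree_ge hσ hb0 hn hbn (by linarith) c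
      have := (abs_lt.1 (hF c)).1
      linarith
    have h2 := sum_le_sum fun c (_ : c ∈ univ) => h1 c
    rw [sum_const, card_univ, Fintype.card_fin, nsmul_eq_mul] at h2
    rw [hA]
    push_cast at h2 ⊢
    linarith
  have hB' : (B : ℝ) ≤ n * (6 * ((1 / 2 + 2 * t) * Real.exp (-(bParam 4 t * (1 / 2 - 2 * t))) + t)
    + 4 * (bParam 4 t / 2 * (3 / 4 + t) * (1 / 2 + 2 * t)
      * Real.exp (-(bParam 4 t * (1 / 2 - 2 * t))) + t)) := by
    have h1 : ∀ p ∈ colorPairs 4, ((freeSet σ {p.1, p.2} G).card : ℝ)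
        ≤ n * ((1 / 2 + 2 * t) * Real.exp (-(bParam 4 t * (1 / 2 - 2 * t))) + t) := by
      intro p hp
      have := meanFree_le hσ hb0 hn hbn' (mem_filter.1 hp).2.ne
      have := (abs_lt.1 (hD p.1 p.2)).2
      linarith
    have h2 : ∀ c, ((conflictSet σ c G).card : ℝ) ≤ n * (bParam 4 t / 2 * (3 / 4 + t)
        * (1 / 2 + 2 * t) * Real.exp (-(bParam 4 t * (1 / 2 - 2 * t))) + t) := by
      intro c
      have := meanConflict_le hσ ht0.le hb0 hn hbn' c
      have := (abs_lt.1 (hE c)).2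
      linarith
    have h3 := sum_le_sum h1
    have h4 := sum_le_sum fun c (_ : c ∈ univ) => h2 c
    rw [sum_const, nsmul_eq_mul, show (colorPairs 4).card = 6 by decide] at h3
    rw [sum_const, card_univ, Fintype.card_fin, nsmul_eq_mul] at h4
    rw [hB]
    push_cast at h3 h4 ⊢
    linarith
  have l1 : 0 ≤ Real.log 2 := Real.log_nonneg (by norm_num)
  have l2 : 0 ≤ Real.log (4 / 3) := Real.log_nonneg (by norm_num)
  have m1 := mul_le_mul_of_nonneg_right hA' l1
  have m2 := mul_le_mul_of_nonneg_right hB' l2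
  unfold recolorRate
  linarith

lemma eventually_tendsto_colorings_four (C : Finset (Fin 4)) :
    ∀ᶠ t in 𝓝[>] (0 : ℝ), Tendsto (fun n => sbmProb n (uniformDist 4)
      (symmMatrix 4 0 (bParam 4 t)) (fun σ G => Balanced t σ ∧
        ((colorings (k := 4) C (1 + (4 : ℕ) * t) G).card : ℝ) < Real.exp (0.094 * n)))
      atTop (𝓝 0) := by
  filter_upwards [nhdsWithin_le_nhds eventually_recolorRate,
    Ioo_mem_nhdsGT (show (0 : ℝ) < 1 / 8 by norm_num)] with t hrate ht
  obtain ⟨ht0, ht8⟩ := ht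
  have hb0 : 0 ≤ bParam 4 t := bParam_nonneg (by norm_num) (by linarith)
  have hQ := symmMatrix_zero_nonneg (k := 4) hb0
  have hp := uniformDist_nonneg 4
  have hp1 := sum_uniformDist (k := 4) (by norm_num)
  have hlarge : ∀ᶠ n : ℕ in atTop, bParam 4 t ≤ n ∧ 0 < n ∧ bParam 4 t / n ≤ t := by
    refine (tendsto_natCast_atTop_atTop.eventually_ge_atTop _).and
      ((eventually_gt_atTop 0).and ?_)
    exact (tendsto_const_div_atTop_nhds_zero_nat (bParam 4 t)).eventually_le_const ht0
  have hlim : ∀ {E : (n : ℕ) → Labels n 4 → SimpleGraph (Fin n) → Prop} {K : ℝ}, 0 ≤ K →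
      (∀ n : ℕ, bParam 4 t ≤ n → 0 < n → ∀ σ : Labels n 4,
        graphExp (symmMatrix 4 0 (bParam 4 t)) σ (fun G => if E n σ G then 1 else 0) ≤ K / n) →
      Tendsto (fun n => sbmProb n (uniformDist 4) (symmMatrix 4 0 (bParam 4 t)) (fun σ G =>
        True ∧ E n σ G)) atTop (𝓝 0) := by
    intro E K hK h
    refine tendsto_of_tendsto_of_tendsto_of_le_of_le' tendsto_const_nhds
      (tendsto_const_div_atTop_nhds_zero_nat K)
      (Eventually.of_forall fun n => sbmProb_nonneg hp hQ _) ?_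
    filter_upwards [hlarge] with n hn
    exact sbmProb_and_le hp hp1 (by positivity) fun σ _ => h n hn.1 hn.2.1 σ
  have hF := tendsto_sbmProb_exists hp hQ fun c : Fin 4 => hlim
    (E := fun n σ G => t * n ≤ |((freeSet σ {c} G).card : ℝ) - meanFree (bParam 4 t) σ {c}|)
    (by positivity) fun n h1 h2 σ => graphExp_freeSet_deviation_le hb0 h1 h2 σ {c} ht0
  have hD := tendsto_sbmProb_exists hp hQ fun c : Fin 4 × Fin 4 => hlim
    (E := fun n σ G =>
      t * n ≤ |((freeSet σ {c.1, c.2} G).card : ℝ) - meanFree (bParam 4 t) σ {c.1, c.2}|)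
    (by positivity) fun n h1 h2 σ => graphExp_freeSet_deviation_le hb0 h1 h2 σ {c.1, c.2} ht0
  have hE := tendsto_sbmProb_exists hp hQ fun c : Fin 4 => hlim
    (E := fun n σ G => t * n ≤ |((conflictSet σ c G).card : ℝ) - meanConflict (bParam 4 t) σ c|)
    (by positivity) fun n h1 h2 σ => graphExp_conflictSet_deviation_le hb0 h1 h2 σ c ht0
  have hP : Tendsto (fun n => sbmProb n (uniformDist 4) (symmMatrix 4 0 (bParam 4 t))
      (fun σ G => ¬ Proper G σ)) atTop (𝓝 0) := by
    simp only [sbmProb_not_proper]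
    exact tendsto_const_nhds
  have hFD := tendsto_sbmProb_zero_of_imp_or hp hQ hF hD (Eventually.of_forall fun n σ G h => h)
  have hEP := tendsto_sbmProb_zero_of_imp_or hp hQ hE hP (Eventually.of_forall fun n σ G h => h)
  refine tendsto_sbmProb_zero_of_imp_or hp hQ hFD hEP ?_
  filter_upwards [hlarge] with n hn σ G h
  by_contra! hcon
  obtain ⟨⟨h1, h2⟩, h3, h4⟩ := hcon
  refine absurd h.2 (not_lt.2 ?_)
  rw [card_colorings_of_one_le (by push_cast; linarith)]
  refine le_trans (Real.exp_le_exp.2 (mul_le_mul_of_nonneg_right hrate.le n.cast_nonneg))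
    (exp_le_card_proper ht0 ht8.le hn.2.1 hn.2.2 h.1 h4 (fun c => h1 c trivial)
      (fun c d => h2 (c, d) trivial) fun c => h3 c trivial)

/-! ### Detection slightly below the threshold and the conclusion -/

/-- With `a = 0` and four communities, detection is solvable slightly below the Kesten-Stigum
threshold. -/
theorem eventually_detectionSolvable_four :
    ∀ᶠ t in 𝓝[>] (0 : ℝ), DetectionSolvable 4 0 (bParam 4 t) := by
  -- The true rates are about 0.0917 for flat colourings and 0.0950 for recolourings; `r := 1` drops
  -- the size condition.
  refine detectionSolvable_of_exponent_lt (by norm_num) {0, 1} (r := 1) (s := 0.0918) (s' := 0.094)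
    (by norm_num) (fun ν h0 h1 h2 _ => ?_) (eventually_tendsto_colorings_four _)
  exact (exponent_zero_four_le ν h0 (fun i => by rw [h1]; norm_num) h2).trans_lt four_threshold_lt

/-- With `a = 0` and at least five communities, detection is solvable slightly below the
Kesten-Stigum threshold. -/
theorem eventually_detectionSolvable_of_five_le {k : ℕ} (hk : 5 ≤ k) :
    ∀ᶠ t in 𝓝[>] (0 : ℝ), DetectionSolvable k 0 (bParam k t) := by
  obtain ⟨C, -, hC⟩ := exists_subset_card_eq (s := (univ : Finset (Fin k))) (n := 2)
    (by rw [card_univ, Fintype.card_fin]; omega)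
  -- With s' = 0 a single candidate suffices, and σ is one: it is proper, and balance puts the size
  -- of its colour set within 2t ≤ kt of 2/k.
  refine detectionSolvable_of_exponent_lt (by omega) C (r := 0) (s := -1 / 200) (s' := 0)
    (by norm_num) (exponent_zero_lt_of_five_le hk hC) ?_
  filter_upwards [Ioo_mem_nhdsGT (show (0 : ℝ) < 1 by norm_num)] with t ht
  have hQ := symmMatrix_zero_nonneg (k := k) (bParam_nonneg (k := k) (by omega) ht.2.le)
  have hP : Tendsto (fun n => sbmProb n (uniformDist k) (symmMatrix k 0 (bParam k t))
      (fun σ G => ¬ Proper G σ)) atTop (𝓝 0) := by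
    simp only [sbmProb_not_proper]
    exact tendsto_const_nhds
  refine tendsto_sbmProb_zero_of_imp_or (uniformDist_nonneg k) hQ hP hP
    (Eventually.of_forall fun n σ G h => Or.inl fun hσ => absurd h.2 (not_lt.2 ?_))
  rw [zero_mul, Real.exp_zero, Nat.one_le_cast, Nat.one_le_iff_ne_zero, card_ne_zero]
  refine ⟨σ, ?_⟩
  simp only [colorings, mem_filter, mem_univ, true_and, zero_add]
  refine ⟨hσ, (h.1.abs_colorSet_le C).trans (mul_le_mul_of_nonneg_right ?_ ht.1.le)⟩
  rw [hC]
  exact_mod_cast (by omega : 2 ≤ k)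

lemma snr_bParam {k : ℕ} (hk : 2 ≤ k) {t : ℝ} (ht : t < 1) : snr k 0 (bParam k t) = 1 - t := by
  have : (2 : ℝ) ≤ k := by exact_mod_cast hk
  have h1 : (k : ℝ) - 1 ≠ 0 := by linarith
  have h2 : 1 - t ≠ 0 := by linarith
  unfold snr bParam
  field_simp
  ring

lemma exists_solvable {k : ℕ} (hk : 2 ≤ k)
    (h : ∀ᶠ t in 𝓝[>] (0 : ℝ), DetectionSolvable k 0 (bParam k t)) :
    ∃ b : ℝ, 0 < b ∧ snr k 0 b < 1 ∧ DetectionSolvable k 0 b ∧ MaxDetectionSolvable k 0 b := by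
  obtain ⟨t, hd, ht0, ht1⟩ :=
    (h.and (Ioo_mem_nhdsGT (show (0 : ℝ) < 1 by norm_num))).exists
  have hk' : (2 : ℝ) ≤ k := by exact_mod_cast hk
  have hb : 0 < bParam k t :=
    mul_pos (mul_pos (by linarith) (by linarith)) (by linarith)
  refine ⟨bParam k t, hb, ?_, hd, MaxDetectionSolvable.of_detectionSolvable hk le_rfl hb.le hd⟩
  rw [snr_bParam hk ht1]
  linarith

end BlockModel

theorem mainTheorem4 :
    (∀ k : ℕ, 4 ≤ k → ∃ a b : ℝ, 0 ≤ a ∧ 0 ≤ b ∧ 0 < a + ((k : ℝ) - 1) * b ∧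
      BlockModel.snr k a b < 1 ∧
      BlockModel.DetectionSolvable k a b ∧ BlockModel.MaxDetectionSolvable k a b) ∧
    (∃ b : ℝ, 0 < b ∧ BlockModel.snr 4 0 b < 1 ∧
      BlockModel.DetectionSolvable 4 0 b ∧ BlockModel.MaxDetectionSolvable 4 0 b) := by
  refine ⟨fun k hk => ?_, BlockModel.exists_solvable (by norm_num)
    BlockModel.eventually_detectionSolvable_four⟩
  have h : ∀ᶠ t in 𝓝[>] (0 : ℝ), BlockModel.DetectionSolvable k 0 (BlockModel.bParam k t) := by
    rcases hk.eq_or_lt with rfl | hk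
    · exact BlockModel.eventually_detectionSolvable_four
    · exact BlockModel.eventually_detectionSolvable_of_five_le hk
  obtain ⟨b, hb, hs, hd, hm⟩ := BlockModel.exists_solvable (by omega) h
  have hk' : (4 : ℝ) ≤ k := by exact_mod_cast hk
  refine ⟨0, b, le_rfl, hb.le, ?_, hs, hd, hm⟩
  rw [zero_add]
  exact mul_pos (by linarith) hb
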